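/- Work in the Euclidean plane. A \emph{Reuleaux polygon} of width $w>0$ is a compact convex region $R$ of constant width $w$ whose boundary consists of finitely many circular arcs of radius $w$; its vertices are its corners, i.e. the points of $R$ with more than one supporting line. A \emph{Reinhardt polygon} is an equilateral convex polygon $P$ that can be inscribed in a Reuleaux polygon $R$ in such a way that every vertex of $R$ is a vertex of $P$. Joining the vertices of $R$ that are at distance $w$ gives a star polygon; if $P$ has $n$ sides, each angle of this star polygon is an integer multiple $k_i\pi/n$ of $\pi/n$, and the integers $k_1,\ldots,k_\ell$, listed in the order in which the angles are met along the edges of the star polygon, form a composition $[k_1,\ldots,k_\ell]$ of $n$ into an odd number $\ell$ of positive parts. Two compositions are equivalent if they differ by a cyclic rotation of the parts, possibly combined with a reversal; an equivalence class is called a \emph{dihedral composition}. Reinhardt $n$-gons are counted up to dihedral equivalence, that is, by their dihedral compositions. A Reinhardt $n$-gon is \emph{periodic} if, for some divisor $m<n$ of $n$, its composition consists of a composition of $m$ into an odd number of parts repeated $n/m$ times, and \emph{sporadic} otherwise. Let $E_0(n)$ and $E_1(n)$ be the numbers of periodic and of sporadic Reinhardt polygons with $n$ sides, counted up to dihedral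 equivalence. \textbf{Theorem.} For almost all positive integers $n$, the number of sporadic Reinhardt polygons exceeds the number of periodic ones: \[ \lim_{N\to\infty}\frac{\#\{1\le n\le N : E_1(n)>E_0(n)\}}{N}=1 . \] -/

import Mathlib

namespace Reinhardt

/-! ### Dihedral compositions -/

/-- Two compositions of `n` are dihedrally equivalent if one is obtained from the other by a cyclic
rotation of its parts, possibly preceded by a reversal. Only compositions with an odd number of
parts are considered. -/
def dihedralSetoid (n : ℕ) : Setoid {c : Composition n // Odd c.length} where
  r c d := c.1.blocks.IsRotated d.1.blocks ∨ c.1.blocks.reverse.IsRotated d.1.blocks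
  iseqv := by
    refine ⟨fun c => Or.inl (List.IsRotated.refl _), ?_, ?_⟩
    · rintro c d (h | h)
      · exact Or.inl h.symm
      · right
        have := h.symm.reverse
        rwa [List.reverse_reverse] at this
    · rintro c d e (h | h) (h' | h')
      · exact Or.inl (h.trans h')
      · exact Or.inr (h.reverse.trans h')
      · exact Or.inr (h.trans h')
      · left
        have := h.reverse.trans h'
        rwa [List.reverse_reverse] at this

/-- A dihedral composition of `n`: a dihedral equivalence class of compositions of `n` into an odd
number of parts. -/
def DihedralComposition (n : ℕ) : Type := Quotient (dihedralSetoid n)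

/-- A composition of `n` is periodic if, for some divisor `m < n` of `n`, it is a composition of `m`
into an odd number of parts, repeated `n / m` times. -/
def IsPeriodicComposition {n : ℕ} (c : Composition n) : Prop :=
  ∃ m : ℕ, m ∣ n ∧ m < n ∧ ∃ d : Composition m, Odd d.length ∧
    c.blocks = (List.replicate (n / m) d.blocks).flatten

/-- A dihedral composition is periodic if it is the class of a periodic composition. -/
def DihedralComposition.IsPeriodic {n : ℕ} (x : DihedralComposition n) : Prop :=
  ∃ c : {c : Composition n // Odd c.length},
    Quotient.mk (dihedralSetoid n) c = x ∧ IsPeriodicComposition c.1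

/-! ### Convex polygons in the Euclidean plane `ℂ` -/

/-- A (strictly) convex `n`-gon, `n ≥ 3`, its vertices being listed in counterclockwise order:
every vertex that is not an endpoint of a given side lies strictly to the left of that side. -/
def IsConvexPolygon {n : ℕ} (P : Polygon ℂ n) : Prop :=
  3 ≤ n ∧ ∀ i j : Fin n, j ≠ i → j ≠ finRotate n i →
    0 < ((starRingEnd ℂ) (P (finRotate n i) - P i) * (P j - P i)).im

/-- All sides of the polygon have the same length. -/
def IsEquilateral {n : ℕ} (P : Polygon ℂ n) : Prop :=
  ∀ i j : Fin n, dist (P i) (P (finRotate n i)) = dist (P j) (P (finRotate n j))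

/-! ### Reuleaux polygons -/

/-- `K` has width `w` in every direction. -/
def HasConstantWidth (K : Set ℂ) (w : ℝ) : Prop :=
  ∀ u : ℂ, ‖u‖ = 1 →
    sSup ((fun x : ℂ => inner ℝ u x) '' K) - sInf ((fun x : ℂ => inner ℝ u x) '' K) = w

/-- A Reuleaux polygon of width `w > 0`: a compact convex region of constant width `w` whose
boundary consists of finitely many circular arcs of radius `w`. -/
structure IsReuleauxPolygon (K : Set ℂ) (w : ℝ) : Prop where
  width_pos : 0 < w
  isCompact : IsCompact K
  convex : Convex ℝ K
  constantWidth : HasConstantWidth K w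
  arcs : ∃ C : Finset ℂ, frontier K ⊆ ⋃ c ∈ C, Metric.sphere c w

/-- The vertices (corners) of a convex region `K`: the points of `K` with more than one
supporting line, that is, with more than one outward unit normal vector. -/
def corners (K : Set ℂ) : Set ℂ :=
  {x | x ∈ K ∧ {u : ℂ | ‖u‖ = 1 ∧ ∀ y ∈ K, inner ℝ u (y - x) ≤ 0}.Nontrivial}

/-! ### Reinhardt polygons -/

/-- `P` is a convex equilateral polygon inscribed in the Reuleaux polygon `K` of width `w`, and
every vertex of `K` is a vertex of `P`. -/
structure IsReinhardtIn {n : ℕ} (P : Polygon ℂ n) (K : Set ℂ) (w : ℝ) : Prop where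
  convex : IsConvexPolygon P
  equilateral : IsEquilateral P
  reuleaux : IsReuleauxPolygon K w
  inscribed : ∀ i, P i ∈ frontier K
  corners_subset : corners K ⊆ Set.range P.vertices

/-- A Reinhardt polygon: a convex equilateral polygon that can be inscribed in a Reuleaux polygon
in such a way that every vertex of the Reuleaux polygon is a vertex of the polygon. -/
def IsReinhardtPolygon {n : ℕ} (P : Polygon ℂ n) : Prop :=
  ∃ (K : Set ℂ) (w : ℝ), IsReinhardtIn P K w

/-- `S` is the star polygon of the Reuleaux polygon `K` of width `w`: it visits every vertex of `K`
exactly once, and consecutive vertices are at distance `w`, the diameter of `K`. -/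
structure IsStarPolygon {l : ℕ} (S : Polygon ℂ l) (K : Set ℂ) (w : ℝ) : Prop where
  injective : Function.Injective S.vertices
  range_eq : Set.range S.vertices = corners K
  dist_eq : ∀ i, dist (S i) (S (finRotate l i)) = w

/-- The composition `c` of `n` into an odd number of parts describes the `n`-gon `P`: when `P` is
inscribed in a Reuleaux polygon as in the definition of a Reinhardt polygon, the parts of `c`,
multiplied by `π / n`, are the successive angles of the associated star polygon, in the order in
which they are met along its edges. -/
def IsDescribedBy {n : ℕ} (P : Polygon ℂ n) (c : {c : Composition n // Odd c.length}) : Prop :=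
  ∃ (K : Set ℂ) (w : ℝ), IsReinhardtIn P K w ∧
    ∃ S : Polygon ℂ c.1.length, IsStarPolygon S K w ∧
      ∀ i : Fin c.1.length,
        EuclideanGeometry.angle (S i) (S (finRotate _ i)) (S (finRotate _ (finRotate _ i))) =
          c.1.blocksFun (finRotate _ i) * (Real.pi / n)

/-- The dihedral equivalence classes of Reinhardt polygons with `n` sides, given by the dihedral
compositions of these polygons. -/
def reinhardtClasses (n : ℕ) : Set (DihedralComposition n) :=
  {x | ∃ P : Polygon ℂ n, IsReinhardtPolygon P ∧
    ∃ c : {c : Composition n // Odd c.length},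
      IsDescribedBy P c ∧ Quotient.mk (dihedralSetoid n) c = x}

/-- The number `E₀(n)` of periodic Reinhardt `n`-gons, counted up to dihedral equivalence. -/
noncomputable def numPeriodic (n : ℕ) : ℕ :=
  {x ∈ reinhardtClasses n | x.IsPeriodic}.ncard

/-- The number `E₁(n)` of sporadic (that is, not periodic) Reinhardt `n`-gons, counted up to
dihedral equivalence. -/
noncomputable def numSporadic (n : ℕ) : ℕ :=
  {x ∈ reinhardtClasses n | ¬ x.IsPeriodic}.ncard

/-! ### Natural density -/

/-- The set `A` of positive integers (membership of `0` is ignored) has natural density `d`. -/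
def HasNaturalDensity (A : Set ℕ) (d : ℝ) : Prop :=
  Filter.Tendsto (fun N : ℕ => ((A ∩ Set.Icc 1 N).ncard : ℝ) / N) Filter.atTop (nhds d)

end Reinhardt

/-! Only an upper bound for periodic classes and a lower bound for all classes are needed. Let `n =
p * q * (r + 2)`, with `p` the least odd prime factor of `n` and `q` another odd prime.

Periodic: a composition with oddly many parts that is repeated `e` times forces `e` to be odd, so `e
≥ p`, and there are at most `2 ^ (n / p) = 2 ^ (q * (r + 2))` periodic classes (`numPeriodic_le`).

All: an antiperiodic binary sequence whose signs are orthogonal to the powers of `exp (π i / n)`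
selects unit steps of increasing direction. They close up to a convex equilateral `n`-gon. Walk
points half a period apart are at distance `walkWidth n`, the maximum possible, so the balls of that
radius around the walk intersect in a Reuleaux polygon; its corners are the points where the walk
pauses, and its angles are the run lengths (`IsBalanced.mk_mem_reinhardtClasses`). Interleaving `r +
2` rows, each of antiperiod `p` or `q`, produces such sequences. Fixing two rows and giving each
other row the `2 ^ q` choices of antiperiod `q` plus one of antiperiod `p` yields `(2 ^ q + 1) ^ r`
of them. A dihedral class contains at most `2 * (n + 1)` compositions, so for fixed `p`, `q` and
large `r` the total exceeds twice the periodic bound (`numPeriodic_lt_numSporadic`).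

Density: since the sum of `1 / p` diverges, all but a small proportion of integers have a prime
factor in each of two suitable disjoint finite sets of odd primes; growth in `r` is uniform over
those finitely many pairs. -/

namespace Reinhardt

/-! ### From balanced sequences to Reinhardt polygons. -/

section Geometry

open Complex Finset
open scoped Real

/-! ### Walks along roots of unity -/

/-- The root of unity `exp (π i / n)`. -/
noncomputable def zeta (n : ℕ) : ℂ := exp ((π / n : ℝ) * I)

theorem zeta_pow (n k : ℕ) : zeta n ^ k = exp ((k * (π / n) : ℝ) * I) := by
  rw [zeta, ← exp_nat_mul]
  push_cast
  ring_nf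

theorem zeta_pow_self {n : ℕ} (hn : n ≠ 0) : zeta n ^ n = -1 := by
  rw [zeta_pow, mul_div_cancel₀ _ (Nat.cast_ne_zero.2 hn), exp_pi_mul_I]

theorem norm_zeta (n : ℕ) : ‖zeta n‖ = 1 := norm_exp_ofReal_mul_I _

theorem norm_zeta_pow (n k : ℕ) : ‖zeta n ^ k‖ = 1 := by rw [norm_pow, norm_zeta, one_pow]

theorem zeta_pow_ne_zero (n k : ℕ) : zeta n ^ k ≠ 0 := by
  rw [← norm_ne_zero_iff, norm_zeta_pow]; exact one_ne_zero

theorem zeta_ne_one {n : ℕ} (hn : n ≠ 0) : zeta n ≠ 1 := by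
  intro h
  have := zeta_pow_self hn
  rw [h, one_pow] at this
  norm_num [Complex.ext_iff] at this

/-- A binary sequence that is antiperiodic with antiperiod `n`, and whose `±1`-valued version
is orthogonal to the powers of `zeta n`. -/
structure IsBalanced (n : ℕ) (g : ℕ → Bool) : Prop where
  antiperiodic : ∀ k, g (k + n) = !g k
  sum_eq_zero : ∑ k ∈ range n, (if g k then 1 else -1) * zeta n ^ k = 0

/-- The partial sums of the powers of `zeta n` selected by `g`. -/
noncomputable def walk (n : ℕ) (g : ℕ → Bool) (k : ℕ) : ℂ :=
  ∑ j ∈ range k, if g j then zeta n ^ j else 0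

/-- The width of the Reuleaux polygons spanned by walks. -/
noncomputable def walkWidth (n : ℕ) : ℝ := ‖(1 - zeta n)⁻¹‖

/-- The unit vector from `walk n g (k + n)` to `walk n g k`. -/
noncomputable def walkNormal (n k : ℕ) : ℂ := zeta n ^ k * (-(1 - zeta n)⁻¹ / walkWidth n)

theorem walkWidth_pos {n : ℕ} (hn : n ≠ 0) : 0 < walkWidth n :=
  norm_pos_iff.2 (inv_ne_zero (sub_ne_zero.2 (zeta_ne_one hn).symm))

theorem norm_walkNormal {n : ℕ} (hn : n ≠ 0) (k : ℕ) : ‖walkNormal n k‖ = 1 := by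
  have h := walkWidth_pos hn
  rw [walkNormal, norm_mul, norm_zeta_pow, norm_div, norm_neg, one_mul, norm_real,
    Real.norm_of_nonneg h.le]
  exact div_self h.ne'

theorem walkNormal_succ (n k : ℕ) : walkNormal n (k + 1) = zeta n * walkNormal n k := by
  rw [walkNormal, walkNormal, pow_succ]; ring

theorem walkNormal_add_self {n : ℕ} (hn : n ≠ 0) (k : ℕ) :
    walkNormal n (k + n) = -walkNormal n k := by
  rw [walkNormal, walkNormal, pow_add, zeta_pow_self hn]; ring

theorem walk_succ (n : ℕ) (g : ℕ → Bool) (k : ℕ) :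
    walk n g (k + 1) = walk n g k + if g k then zeta n ^ k else 0 := sum_range_succ _ _

theorem walk_sub_walk (n : ℕ) (g : ℕ → Bool) {j k : ℕ} (h : j ≤ k) :
    walk n g k - walk n g j = ∑ i ∈ Ico j k, if g i then zeta n ^ i else 0 :=
  (sum_Ico_eq_sub _ h).symm

theorem sum_zeta_pow {n : ℕ} (hn : n ≠ 0) (m : ℕ) :
    ∑ i ∈ range n, zeta n ^ (m + i) = zeta n ^ m * (2 * (1 - zeta n)⁻¹) := by
  have h1 : (1 - zeta n) ≠ 0 := sub_ne_zero.2 (zeta_ne_one hn).symm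
  simp_rw [pow_add, ← mul_sum]
  rw [geom_sum_eq (zeta_ne_one hn), zeta_pow_self hn]
  congr 1
  have h2 : (zeta n - 1) ≠ 0 := sub_ne_zero.2 (zeta_ne_one hn)
  field_simp
  ring

namespace IsBalanced

variable {n : ℕ} {g : ℕ → Bool}

/-- Adding the full geometric sum to the vanishing signed sum doubles the selected steps, which
settles `k = 0`. By antiperiodicity exactly one of `k` and `k + n` is a step, so the displacement
then rotates by `zeta n` whatever `g` is. -/
theorem walk_add (hn : n ≠ 0) (hg : IsBalanced n g) (k : ℕ) :
    walk n g (k + n) = walk n g k + zeta n ^ k * (1 - zeta n)⁻¹ := by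
  have h1 : (1 - zeta n) ≠ 0 := sub_ne_zero.2 (zeta_ne_one hn).symm
  induction k with
  | zero =>
    have h2 := sum_zeta_pow hn 0
    have h3 := hg.sum_eq_zero
    have h4 : walk n g n + walk n g n = ∑ i ∈ range n, zeta n ^ (0 + i) +
        ∑ k ∈ range n, (if g k then 1 else -1) * zeta n ^ k := by
      rw [walk, ← sum_add_distrib, ← sum_add_distrib]
      refine sum_congr rfl fun i _ => ?_
      split_ifs <;> simp
    rw [h2, h3] at h4
    have h5 : walk n g 0 = 0 := by simp [walk]
    rw [zero_add, h5]
    linear_combination h4 / 2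
  | succ k ih =>
    rw [add_right_comm, walk_succ, walk_succ, ih, hg.antiperiodic, pow_add, pow_succ,
      zeta_pow_self hn]
    cases g k <;> simp <;> field_simp <;> ring

theorem walk_add_two (hn : n ≠ 0) (hg : IsBalanced n g) (k : ℕ) :
    walk n g (k + 2 * n) = walk n g k := by
  rw [two_mul, ← add_assoc, hg.walk_add hn, hg.walk_add hn, pow_add, zeta_pow_self hn]
  ring

theorem walk_add_mul (hn : n ≠ 0) (hg : IsBalanced n g) (k m : ℕ) :
    walk n g (k + 2 * n * m) = walk n g k := by
  induction m with
  | zero => simp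
  | succ m ih => rw [mul_add, mul_one, ← add_assoc, hg.walk_add_two hn, ih]

theorem walk_mod (hn : n ≠ 0) (hg : IsBalanced n g) (k : ℕ) :
    walk n g (k % (2 * n)) = walk n g k := by
  conv_rhs => rw [← Nat.mod_add_div k (2 * n), hg.walk_add_mul hn]

theorem seq_add_two (hg : IsBalanced n g) (k : ℕ) : g (k + 2 * n) = g k := by
  rw [two_mul, ← add_assoc, hg.antiperiodic, hg.antiperiodic, Bool.not_not]

theorem walk_eq_add_normal (hn : n ≠ 0) (hg : IsBalanced n g) (k : ℕ) :
    walk n g k = walk n g (k + n) + walkWidth n • walkNormal n k := by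
  have h : (walkWidth n : ℂ) ≠ 0 := ofReal_ne_zero.2 (walkWidth_pos hn).ne'
  rw [hg.walk_add hn, walkNormal, real_smul]
  field_simp
  ring

end IsBalanced

theorem exists_eq_walkNormal_combination {n : ℕ} (hn : 2 ≤ n) {u : ℂ} (hu : ‖u‖ = 1) :
    ∃ (j : ℕ) (a b : ℝ), 0 ≤ a ∧ 0 ≤ b ∧
      u = a • walkNormal n j + b • walkNormal n (j + 1) := by
  have hn0 : n ≠ 0 := by omega
  have hnr : (0 : ℝ) < n := by positivity
  have hn2 : (2 : ℝ) ≤ n := by exact_mod_cast hn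
  set δ : ℝ := π / n with hδ
  have hδ0 : 0 < δ := div_pos Real.pi_pos hnr
  have hδ1 : δ < π := by
    rw [hδ, div_lt_iff₀ hnr]; nlinarith [Real.pi_pos]
  have hs : 0 < Real.sin δ := Real.sin_pos_of_pos_of_lt_pi hδ0 hδ1
  have h0 : walkNormal n 0 ≠ 0 := by
    rw [← norm_ne_zero_iff, norm_walkNormal hn0]; exact one_ne_zero
  set v := u / walkNormal n 0 with hv
  have hv1 : ‖v‖ = 1 := by rw [hv, norm_div, hu, norm_walkNormal hn0, div_one]
  -- The turn by `2 * π` makes the angle nonnegative, so that a natural floor locates the sector.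
  set θ := v.arg + 2 * π with hθ
  have hθ0 : 0 ≤ θ := by have := neg_pi_lt_arg v; linarith [Real.pi_pos]
  have hvθ : v = exp (θ * I) := by
    have h1 := norm_mul_exp_arg_mul_I v
    rw [hv1, ofReal_one, one_mul] at h1
    rw [hθ, ofReal_add, add_mul, exp_add, h1]
    push_cast
    rw [exp_two_pi_mul_I, mul_one]
  have hj1 := Nat.floor_le (div_nonneg hθ0 hδ0.le)
  have hj2 := Nat.lt_floor_add_one (θ / δ)
  set j := ⌊θ / δ⌋₊
  rw [le_div_iff₀ hδ0] at hj1
  rw [div_lt_iff₀ hδ0] at hj2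
  set τ := θ - j * δ with hτ
  refine ⟨j, Real.sin (δ - τ) / Real.sin δ, Real.sin τ / Real.sin δ,
    div_nonneg (Real.sin_nonneg_of_nonneg_of_le_pi (by linarith) (by linarith)) hs.le,
    div_nonneg (Real.sin_nonneg_of_nonneg_of_le_pi (by linarith) (by linarith)) hs.le, ?_⟩
  have e1 : walkNormal n j = exp ((j * δ : ℝ) * I) * walkNormal n 0 := by
    rw [walkNormal, walkNormal, zeta_pow, pow_zero, one_mul]
  have e2 : u = exp (τ * I) * walkNormal n j := by
    have : u = v * walkNormal n 0 := by rw [hv]; field_simp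
    rw [this, hvθ, e1, ← mul_assoc, ← exp_add, hτ]
    congr 2
    push_cast
    ring
  have e3 : exp (τ * I) = (Real.sin (δ - τ) / Real.sin δ : ℝ) +
      (Real.sin τ / Real.sin δ : ℝ) * zeta n := by
    have hs' := hs.ne'
    rw [zeta, ← hδ]
    apply Complex.ext
    · simp only [exp_ofReal_mul_I_re, add_re, ofReal_re, re_ofReal_mul]
      rw [Real.sin_sub]; field_simp; ring
    · simp only [exp_ofReal_mul_I_im, add_im, ofReal_im, im_ofReal_mul]
      field_simp; ring
  rw [walkNormal_succ, real_smul, real_smul, e2, e3]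
  ring

/-! ### The diameter of a balanced walk -/

theorem sum_range_add_of_periodic {M : Type*} [AddCommGroup M] {f : ℕ → M} {n : ℕ}
    (hf : ∀ i, f (i + n) = f i) (m : ℕ) :
    ∑ i ∈ range n, f (m + i) = ∑ i ∈ range n, f i := by
  induction m with
  | zero => simp
  | succ m ih =>
    have h1 := sum_range_succ (fun i => f (m + i)) n
    have h2 := sum_range_succ' (fun i => f (m + i)) n
    rw [← ih]
    rw [h2, hf] at h1
    simpa [add_assoc, add_comm 1] using h1

theorem inner_exp_exp (s t : ℝ) :
    inner ℝ (exp (s * I)) (exp (t * I)) = Real.cos (t - s) := by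
  rw [Complex.inner, mul_comm, ← exp_conj, ← exp_add, map_mul, conj_I, conj_ofReal,
    ← exp_ofReal_mul_I_re]
  congr 2
  push_cast
  ring

/-- The summand has period `n`, so the window can be moved to `n` consecutive powers in the
half-plane facing `e`. There the absolute values disappear and the geometric sum has norm `2 *
walkWidth n`. -/
theorem sum_abs_inner_zeta_pow_le {n : ℕ} (hn : n ≠ 0) {e : ℂ} (he : ‖e‖ = 1) :
    ∑ i ∈ range n, |inner ℝ e (zeta n ^ i)| ≤ 2 * walkWidth n := by
  have hnr : (0 : ℝ) < n := by positivity
  set δ : ℝ := π / n with hδ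
  have hδ0 : 0 < δ := div_pos Real.pi_pos hnr
  have hδn : n * δ = π := mul_div_cancel₀ _ hnr.ne'
  set ψ := e.arg + 2 * π with hψ
  have hψ0 : 0 ≤ ψ - π / 2 := by have := neg_pi_lt_arg e; linarith [Real.pi_pos]
  have heψ : e = exp (ψ * I) := by
    have h1 := norm_mul_exp_arg_mul_I e
    rw [he, ofReal_one, one_mul] at h1
    rw [hψ, ofReal_add, add_mul, exp_add, h1]
    push_cast
    rw [exp_two_pi_mul_I, mul_one]
  have hm1 := Nat.le_ceil ((ψ - π / 2) / δ)
  have hm2 := Nat.ceil_lt_add_one (div_nonneg hψ0 hδ0.le)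
  set m := ⌈(ψ - π / 2) / δ⌉₊
  rw [div_le_iff₀ hδ0] at hm1
  rw [← sub_lt_iff_lt_add, lt_div_iff₀ hδ0] at hm2
  have hpos : ∀ i ∈ range n, 0 ≤ inner ℝ e (zeta n ^ (m + i)) := by
    intro i hi
    rw [heψ, zeta_pow, inner_exp_exp]
    have hi' : (i : ℝ) + 1 ≤ n := by exact_mod_cast mem_range.1 hi
    have := mul_le_mul_of_nonneg_right hi' hδ0.le
    have hi0 : 0 ≤ (i : ℝ) * δ := by positivity
    apply Real.cos_nonneg_of_mem_Icc
    constructor <;> push_cast <;> linarith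
  have hper : ∀ i, |inner ℝ e (zeta n ^ (i + n))| = |inner ℝ e (zeta n ^ i)| := by
    intro i
    rw [pow_add, zeta_pow_self hn, mul_neg_one, inner_neg_right, abs_neg]
  calc ∑ i ∈ range n, |inner ℝ e (zeta n ^ i)|
      = ∑ i ∈ range n, |inner ℝ e (zeta n ^ (m + i))| :=
        (sum_range_add_of_periodic (f := fun i => |inner ℝ e (zeta n ^ i)|) hper m).symm
    _ = ∑ i ∈ range n, inner ℝ e (zeta n ^ (m + i)) :=
        sum_congr rfl fun i hi => abs_of_nonneg (hpos i hi)
    _ = inner ℝ e (zeta n ^ m * (2 * (1 - zeta n)⁻¹)) := by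
        rw [← inner_sum, sum_zeta_pow hn]
    _ ≤ ‖e‖ * ‖zeta n ^ m * (2 * (1 - zeta n)⁻¹)‖ := real_inner_le_norm _ _
    _ = 2 * walkWidth n := by
        rw [he, norm_mul, norm_zeta_pow, norm_mul, walkWidth]; norm_num

namespace IsBalanced

variable {n : ℕ} {g : ℕ → Bool}

/-- Project the closed walk on the direction `e` of the displacement. The steps inside and outside
`[j, k)` have opposite sums, so twice the displacement is at most the total variation over a period.
-/
theorem norm_walk_sub_walk_le (hn : n ≠ 0) (hg : IsBalanced n g) (j k : ℕ) :
    ‖walk n g j - walk n g k‖ ≤ walkWidth n := by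
  rw [← hg.walk_mod hn j, ← hg.walk_mod hn k]
  have hj := Nat.mod_lt j (show 2 * n > 0 by omega)
  have hk := Nat.mod_lt k (show 2 * n > 0 by omega)
  generalize j % (2 * n) = j at hj
  generalize k % (2 * n) = k at hk
  wlog hjk : j ≤ k generalizing j k
  · rw [norm_sub_rev]
    exact this k hk j hj (le_of_not_ge hjk)
  rw [norm_sub_rev]
  set D := walk n g k - walk n g j with hD
  rcases eq_or_ne D 0 with h0 | h0
  · rw [h0, norm_zero]; exact (walkWidth_pos hn).le
  have hDn : ‖D‖ ≠ 0 := norm_ne_zero_iff.2 h0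
  set e : ℂ := ‖D‖⁻¹ • D with he
  have he1 : ‖e‖ = 1 := by rw [he, norm_smul, norm_inv, norm_norm, inv_mul_cancel₀ hDn]
  have heD : inner ℝ e D = ‖D‖ := by
    rw [he, real_inner_smul_left, real_inner_self_eq_norm_sq]; field_simp
  set F : ℕ → ℝ := fun i => if g i then inner ℝ e (zeta n ^ i) else 0 with hF
  have hFe : ∀ s : Finset ℕ, inner ℝ e (∑ i ∈ s, if g i then zeta n ^ i else 0) =
      ∑ i ∈ s, F i := by
    intro s
    rw [inner_sum]
    refine sum_congr rfl fun i _ => ?_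
    simp only [hF]
    split_ifs <;> simp
  have htot : ∑ i ∈ range (2 * n), F i = 0 := by
    rw [← hFe]
    have := hg.walk_add_two hn 0
    simp only [walk, zero_add, range_zero, sum_empty] at this
    rw [this, inner_zero_right]
  have hDs : ‖D‖ = ∑ i ∈ Ico j k, F i := by
    rw [← heD, hD, walk_sub_walk n g hjk, hFe]
  have hsub : Ico j k ⊆ range (2 * n) := fun i hi => by
    rw [mem_Ico] at hi; rw [mem_range]; omega
  have hsplit := sum_sdiff (f := F) hsub
  have hsplit' := sum_sdiff (f := fun i => |F i|) hsub
  have h1 : ∑ i ∈ Ico j k, F i ≤ ∑ i ∈ Ico j k, |F i| := sum_le_sum fun i _ => le_abs_self _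
  have h2 : -∑ i ∈ range (2 * n) \ Ico j k, F i ≤ ∑ i ∈ range (2 * n) \ Ico j k, |F i| := by
    rw [← sum_neg_distrib]
    exact sum_le_sum fun i _ => neg_le_abs _
  -- Exactly one of `i` and `i + n` is selected, and their directions are opposite.
  have h3 : ∑ i ∈ range (2 * n), |F i| = ∑ i ∈ range n, |inner ℝ e (zeta n ^ i)| := by
    rw [two_mul, sum_range_add, ← sum_add_distrib]
    refine sum_congr rfl fun i _ => ?_
    simp only [hF]
    rw [add_comm n i, hg.antiperiodic, pow_add, zeta_pow_self hn, mul_neg_one, inner_neg_right]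
    generalize inner ℝ e (zeta n ^ i) = t
    cases g i <;> simp
  have h4 := sum_abs_inner_zeta_pow_le hn he1
  linarith

end IsBalanced

/-! ### The convex region spanned by a balanced walk -/

/-- The intersection of the balls of radius `walkWidth n` centred at the points of a walk. -/
def walkHull (n : ℕ) (g : ℕ → Bool) : Set ℂ := ⋂ k, Metric.closedBall (walk n g k) (walkWidth n)

theorem mem_walkHull {n : ℕ} {g : ℕ → Bool} {x : ℂ} :
    x ∈ walkHull n g ↔ ∀ k, ‖x - walk n g k‖ ≤ walkWidth n := by
  simp [walkHull, dist_eq_norm]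

/-- For a unit vector `e`, `‖y - w • e‖ ≤ w` amounts to `‖y‖ ^ 2 ≤ 2 * w * inner ℝ y e`. Such
inequalities combine with weights `a`, `b`, because `a + b ≥ 1`. -/
theorem norm_sub_arc_le {V : Type*} [NormedAddCommGroup V] [InnerProductSpace ℝ V] {w a b : ℝ}
    (hw : 0 ≤ w) (ha : 0 ≤ a) (hb : 0 ≤ b) {y e₁ e₂ : V} (h₁ : ‖e₁‖ = 1) (h₂ : ‖e₂‖ = 1)
    (hu : ‖a • e₁ + b • e₂‖ = 1) (hy₁ : ‖y - w • e₁‖ ≤ w) (hy₂ : ‖y - w • e₂‖ ≤ w) :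
    ‖y - w • (a • e₁ + b • e₂)‖ ≤ w := by
  have key : ∀ e : V, ‖e‖ = 1 →
      ‖y - w • e‖ ^ 2 = ‖y‖ ^ 2 - 2 * (w * inner ℝ y e) + w ^ 2 := by
    intro e he
    rw [norm_sub_sq_real, real_inner_smul_right, norm_smul, he, mul_one, Real.norm_of_nonneg hw]
  have hab : 1 ≤ a + b := by
    rw [← hu]
    refine (norm_add_le _ _).trans_eq ?_
    rw [norm_smul, norm_smul, h₁, h₂, Real.norm_of_nonneg ha, Real.norm_of_nonneg hb]; ring
  have k₁ := pow_le_pow_left₀ (norm_nonneg _) hy₁ 2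
  have k₂ := pow_le_pow_left₀ (norm_nonneg _) hy₂ 2
  rw [key _ h₁] at k₁
  rw [key _ h₂] at k₂
  refine le_of_sq_le_sq ?_ hw
  rw [key _ hu, inner_add_right, real_inner_smul_right, real_inner_smul_right]
  nlinarith [mul_le_mul_of_nonneg_left k₁ ha, mul_le_mul_of_nonneg_left k₂ hb,
    mul_le_mul_of_nonneg_right hab (sq_nonneg ‖y‖)]

/-- Properties of the supporting lines of a region of width `w` in direction `u`, the region
touching one of them at `p` only and the other one at `p + w • u` only. -/
structure IsSupportPair (K : Set ℂ) (w : ℝ) (u p : ℂ) : Prop where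
  mem : p ∈ K
  mem' : p + w • u ∈ K
  nonneg : ∀ y ∈ K, 0 ≤ inner ℝ u (y - p)
  le : ∀ y ∈ K, inner ℝ u (y - p) ≤ w
  eq : ∀ y ∈ K, inner ℝ u (y - p) ≤ 0 → y = p
  eq' : ∀ y ∈ K, w ≤ inner ℝ u (y - p) → y = p + w • u

namespace IsBalanced

variable {n : ℕ} {g : ℕ → Bool}

theorem walk_mem_walkHull (hn : n ≠ 0) (hg : IsBalanced n g) (k : ℕ) :
    walk n g k ∈ walkHull n g :=
  mem_walkHull.2 fun j => hg.norm_walk_sub_walk_le hn k j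

theorem inner_walkNormal_le (hn : n ≠ 0) (hg : IsBalanced n g) {x : ℂ} (hx : x ∈ walkHull n g)
    (k : ℕ) :
    2 * (walkWidth n * inner ℝ (walkNormal n k) (x - walk n g k)) ≤ -‖x - walk n g k‖ ^ 2 := by
  have hw := walkWidth_pos hn
  have h := pow_le_pow_left₀ (norm_nonneg _) (mem_walkHull.1 hx (k + n)) 2
  have e : x - walk n g (k + n) = (x - walk n g k) + walkWidth n • walkNormal n k := by
    linear_combination hg.walk_eq_add_normal hn k
  rw [e, norm_add_sq_real, real_inner_smul_right, norm_smul, norm_walkNormal hn, mul_one,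
    Real.norm_of_nonneg hw.le, real_inner_comm] at h
  linarith

/-- While the walk steps from `j` to `j + 1`, its antipode at `j + n` pauses. The boundary arc
joining the two ends of the step is centred at that antipode, and `u` points to this arc. -/
theorem isSupportPair (hn : n ≠ 0) (hg : IsBalanced n g) {j : ℕ} (hj : g j = true) {a b : ℝ}
    (ha : 0 ≤ a) (hb : 0 ≤ b) {u : ℂ} (hu : ‖u‖ = 1)
    (h : u = a • walkNormal n j + b • walkNormal n (j + 1)) :
    IsSupportPair (walkHull n g) (walkWidth n) u (walk n g (j + n)) := by
  have hw := walkWidth_pos hn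
  have hc : walk n g (j + 1 + n) = walk n g (j + n) := by
    rw [add_right_comm, walk_succ, hg.antiperiodic, hj]; simp
  have hj0 := hg.walk_eq_add_normal hn j
  have hj1 := hg.walk_eq_add_normal hn (j + 1)
  rw [hc] at hj1
  set A := walk n g (j + n) with hA
  have hab : 1 ≤ a + b := by
    rw [← hu, h]
    refine (norm_add_le _ _).trans_eq ?_
    rw [norm_smul, norm_smul, norm_walkNormal hn, norm_walkNormal hn, Real.norm_of_nonneg ha,
      Real.norm_of_nonneg hb]
    ring
  have hmain : ∀ y ∈ walkHull n g,
      ‖y - A‖ ^ 2 ≤ 2 * (walkWidth n * inner ℝ u (y - A)) := by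
    intro y hy
    have k1 := hg.inner_walkNormal_le hn hy (j + n)
    have k2 := hg.inner_walkNormal_le hn hy (j + 1 + n)
    rw [hc] at k2
    rw [walkNormal_add_self hn, inner_neg_left] at k1 k2
    rw [h, inner_add_left, real_inner_smul_left, real_inner_smul_left]
    nlinarith [mul_le_mul_of_nonneg_left k1 ha, mul_le_mul_of_nonneg_left k2 hb,
      mul_le_mul_of_nonneg_right hab (sq_nonneg ‖y - A‖)]
  refine ⟨hg.walk_mem_walkHull hn _, mem_walkHull.2 fun k => ?_, fun y hy => ?_, fun y hy => ?_,
    fun y hy h0 => ?_, fun y hy h0 => ?_⟩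
  · have d0 := hg.norm_walk_sub_walk_le hn k j
    have d1 := hg.norm_walk_sub_walk_le hn k (j + 1)
    have := norm_sub_arc_le (y := walk n g k - A) hw.le ha hb (norm_walkNormal hn j)
      (norm_walkNormal hn (j + 1)) (h ▸ hu) (by rwa [sub_sub, ← hj0]) (by rwa [sub_sub, ← hj1])
    rw [← h, sub_sub] at this
    rwa [norm_sub_rev]
  · have := hmain y hy
    have h2 := sq_nonneg ‖y - A‖
    by_contra! h3
    nlinarith [mul_neg_of_pos_of_neg hw h3]
  · refine (real_inner_le_norm _ _).trans ?_
    rw [hu, one_mul]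
    exact mem_walkHull.1 hy _
  · have h1 := hmain y hy
    have h2 : ‖y - A‖ ^ 2 ≤ 0 := h1.trans (by
      have := mul_nonpos_of_nonneg_of_nonpos hw.le h0; linarith)
    have h3 : ‖y - A‖ = 0 := by
      have := sq_nonneg ‖y - A‖
      exact pow_eq_zero_iff (two_ne_zero) |>.1 (le_antisymm h2 this)
    exact sub_eq_zero.1 (norm_eq_zero.1 h3)
  · have h1 := pow_le_pow_left₀ (norm_nonneg _) (mem_walkHull.1 hy (j + n)) 2
    have h2 : ‖y - A - walkWidth n • u‖ ^ 2 ≤ 0 := by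
      rw [norm_sub_sq_real, real_inner_smul_right, norm_smul, hu, mul_one,
        Real.norm_of_nonneg hw.le, real_inner_comm]
      nlinarith [mul_le_mul_of_nonneg_left h0 hw.le]
    have h3 := pow_eq_zero_iff (two_ne_zero) |>.1 (le_antisymm h2 (sq_nonneg _))
    rw [norm_eq_zero, sub_sub, sub_eq_zero] at h3
    exact h3

theorem exists_isSupportPair (hn : 2 ≤ n) (hg : IsBalanced n g) {u : ℂ} (hu : ‖u‖ = 1) :
    ∃ k, g k = false ∧ (IsSupportPair (walkHull n g) (walkWidth n) u (walk n g k) ∨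
      IsSupportPair (walkHull n g) (walkWidth n) (-u) (walk n g k)) := by
  have hn0 : n ≠ 0 := by omega
  obtain ⟨j, a, b, ha, hb, h⟩ := exists_eq_walkNormal_combination hn hu
  cases hj : g j with
  | true =>
    exact ⟨j + n, by rw [hg.antiperiodic, hj]; rfl, Or.inl (hg.isSupportPair hn0 hj ha hb hu h)⟩
  | false =>
    refine ⟨j, hj, Or.inr ?_⟩
    rw [← hg.walk_add_two hn0 j, two_mul, ← add_assoc]
    refine hg.isSupportPair hn0 (by rw [hg.antiperiodic, hj]; rfl) ha hb (by rwa [norm_neg]) ?_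
    rw [add_right_comm, walkNormal_add_self hn0, walkNormal_add_self hn0, h]
    simp only [smul_neg]; abel

theorem finite_range_walk (hn : n ≠ 0) (hg : IsBalanced n g) :
    (Set.range (walk n g)).Finite := by
  refine ((range (2 * n)).image (walk n g)).finite_toSet.subset ?_
  rintro _ ⟨k, rfl⟩
  rw [← hg.walk_mod hn k]
  exact mem_coe.2 (mem_image_of_mem _ (mem_range.2 (Nat.mod_lt _ (by omega))))

end IsBalanced

theorem IsSupportPair.width_eq {K : Set ℂ} {w : ℝ} {u p : ℂ} (hu : ‖u‖ = 1)
    (h : IsSupportPair K w u p) :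
    sSup ((fun x : ℂ => inner ℝ u x) '' K) = inner ℝ u p + w ∧
      sInf ((fun x : ℂ => inner ℝ u x) '' K) = inner ℝ u p := by
  constructor
  · refine IsGreatest.csSup_eq ⟨⟨_, h.mem', ?_⟩, ?_⟩
    · simp only [inner_add_right, real_inner_smul_right, real_inner_self_eq_norm_sq, hu]; ring
    · rintro _ ⟨y, hy, rfl⟩
      have := h.le y hy
      rw [inner_sub_right] at this
      simp only; linarith
  · refine IsLeast.csInf_eq ⟨⟨_, h.mem, rfl⟩, ?_⟩
    rintro _ ⟨y, hy, rfl⟩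
    have := h.nonneg y hy
    rw [inner_sub_right] at this
    simp only; linarith

theorem width_neg (K : Set ℂ) (u : ℂ) :
    sSup ((fun x : ℂ => inner ℝ (-u) x) '' K) - sInf ((fun x : ℂ => inner ℝ (-u) x) '' K) =
      sSup ((fun x : ℂ => inner ℝ u x) '' K) - sInf ((fun x : ℂ => inner ℝ u x) '' K) := by
  have : (fun x : ℂ => inner ℝ (-u) x) '' K = -((fun x : ℂ => inner ℝ u x) '' K) := by
    rw [← Set.image_neg_eq_neg, Set.image_image]
    simp only [inner_neg_left]
  rw [this, Real.sSup_neg, Real.sInf_neg]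
  ring

theorem IsBalanced.isReuleauxPolygon {n : ℕ} {g : ℕ → Bool} (hn : 2 ≤ n) (hg : IsBalanced n g) :
    IsReuleauxPolygon (walkHull n g) (walkWidth n) := by
  have hn0 : n ≠ 0 := by omega
  have hclosed : IsClosed (walkHull n g) := isClosed_iInter fun _ => Metric.isClosed_closedBall
  refine ⟨walkWidth_pos hn0, ?_, convex_iInter fun _ => convex_closedBall _ _, fun u hu => ?_,
    (hg.finite_range_walk hn0).toFinset, fun x hx => ?_⟩
  · exact (isCompact_closedBall _ _).of_isClosed_subset hclosed (Set.iInter_subset _ 0)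
  · obtain ⟨k, -, h | h⟩ := hg.exists_isSupportPair hn hu
    · rw [(h.width_eq hu).1, (h.width_eq hu).2]; ring
    · have hu' : ‖-u‖ = 1 := by rwa [norm_neg]
      rw [← width_neg, (h.width_eq hu').1, (h.width_eq hu').2]; ring
  · by_contra hcon
    rw [frontier, hclosed.closure_eq] at hx
    refine hx.2 (mem_interior.2 ⟨⋂ c ∈ (hg.finite_range_walk hn0).toFinset,
      Metric.ball c (walkWidth n), ?_, ?_, ?_⟩)
    · intro y hy
      rw [mem_walkHull]
      intro k
      have := Set.mem_iInter₂.1 hy (walk n g k) (by simp)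
      rw [Metric.mem_ball, dist_eq_norm] at this
      exact this.le
    · exact isOpen_biInter_finset fun _ _ => Metric.isOpen_ball
    · refine Set.mem_iInter₂.2 fun c hc => ?_
      obtain ⟨k, rfl⟩ : c ∈ Set.range (walk n g) := by simpa using hc
      have hle : dist x (walk n g k) ≤ walkWidth n := by
        rw [dist_eq_norm]; exact mem_walkHull.1 hx.1 k
      refine hle.lt_of_ne fun h => hcon ?_
      exact Set.mem_iUnion₂.2 ⟨_, hc, h⟩

/-! ### The corners of the region spanned by a balanced walk -/

/-- In a finite set some pair of distinct vectors would have the largest inner product, but the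
normalised bisector is closer to either of them. -/
theorem infinite_of_convex_cone {V : Type*} [NormedAddCommGroup V] [InnerProductSpace ℝ V]
    {N : Set V} (hN : N.Nontrivial) (h1 : ∀ u ∈ N, ‖u‖ = 1)
    (hadd : ∀ u ∈ N, ∀ v ∈ N, u + v ≠ 0 ∧ ‖u + v‖⁻¹ • (u + v) ∈ N) : N.Infinite := by
  intro hfin
  obtain ⟨⟨u, v⟩, ⟨hu, hv, huv⟩, hmax⟩ := Set.exists_max_image N.offDiag
    (fun q => inner ℝ q.1 q.2) hfin.offDiag (Set.offDiag_nonempty.2 hN)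
  obtain ⟨h0, hm⟩ := hadd u hu v hv
  simp only at hu hv huv hmax h0 hm
  have hs : 0 < ‖u + v‖ := norm_pos_iff.2 h0
  have hs2 : ‖u + v‖ ^ 2 = 2 + 2 * inner ℝ u v := by
    rw [norm_add_sq_real, h1 u hu, h1 v hv]; ring
  have hd : 0 < 2 - 2 * inner ℝ u v := by
    have h2 : 0 < ‖u - v‖ ^ 2 := pow_pos (norm_pos_iff.2 (sub_ne_zero.2 huv)) 2
    rw [norm_sub_sq_real, h1 u hu, h1 v hv] at h2
    linarith
  have ht : inner ℝ u (‖u + v‖⁻¹ • (u + v)) = ‖u + v‖ / 2 := by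
    rw [real_inner_smul_right, inner_add_right, real_inner_self_eq_norm_sq, h1 u hu]
    field_simp
    linarith
  by_cases hum : u = ‖u + v‖⁻¹ • (u + v)
  · rw [← hum, real_inner_self_eq_norm_sq, h1 u hu] at ht
    have : ‖u + v‖ = 2 := by linarith
    rw [this] at hs2
    linarith
  · have := hmax (u, _) ⟨hu, hm, hum⟩
    simp only [ht] at this
    nlinarith

namespace IsBalanced

variable {n : ℕ} {g : ℕ → Bool}

/-- At any other point each normal `u` satisfies `x = walk n g k + walkWidth n • u` for some `k`.
This leaves finitely many normals, whereas a corner has infinitely many. -/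
theorem corners_subset (hn : 2 ≤ n) (hg : IsBalanced n g) {x : ℂ}
    (hx : x ∈ corners (walkHull n g)) : ∃ k, g k = false ∧ x = walk n g k := by
  have hn0 : n ≠ 0 := by omega
  have hw := walkWidth_pos hn0
  by_contra! hcon
  obtain ⟨hxK, hN⟩ := hx
  have key : ∀ u ∈ {u : ℂ | ‖u‖ = 1 ∧ ∀ y ∈ walkHull n g, inner ℝ u (y - x) ≤ 0},
      ∃ k, x = walk n g k + walkWidth n • u := by
    rintro u ⟨hu, hux⟩
    obtain ⟨k, hk, h | h⟩ := hg.exists_isSupportPair hn hu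
    · refine ⟨k, h.eq' x hxK ?_⟩
      have h1 := hux _ h.mem'
      rw [inner_sub_right, inner_add_right, real_inner_smul_right, real_inner_self_eq_norm_sq,
        hu] at h1
      rw [inner_sub_right]
      linarith
    · refine absurd (h.eq x hxK ?_) (hcon k hk)
      have h1 := hux _ h.mem
      rwa [inner_neg_left, ← inner_neg_right, neg_sub]
  refine infinite_of_convex_cone hN (fun u hu => hu.1) (fun u hu v hv => ?_) ?_
  · have h0 : u + v ≠ 0 := by
      -- Opposite normals would put two walk points at distance `2 * walkWidth n`, beyond the
      -- diameter.
      intro h0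
      obtain ⟨j, hj⟩ := key u hu
      obtain ⟨k, hk⟩ := key v hv
      have h1 := hg.norm_walk_sub_walk_le hn0 k j
      have h2 : walk n g k - walk n g j = (2 * walkWidth n) • u := by
        rw [eq_neg_of_add_eq_zero_right h0] at hk
        have := hk.symm.trans hj
        simp only [real_smul] at this ⊢
        push_cast
        linear_combination this
      rw [h2, norm_smul, hu.1, Real.norm_of_nonneg (by positivity)] at h1
      linarith
    have hs : 0 < ‖u + v‖ := norm_pos_iff.2 h0
    refine ⟨h0, ?_, fun y hy => ?_⟩
    · rw [norm_smul, norm_inv, norm_norm, inv_mul_cancel₀ hs.ne']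
    · rw [real_inner_smul_left, inner_add_left]
      exact mul_nonpos_of_nonneg_of_nonpos (inv_nonneg.2 hs.le)
        (add_nonpos (hu.2 y hy) (hv.2 y hy))
  · refine ((hg.finite_range_walk hn0).image fun p => (walkWidth n)⁻¹ • (x - p)).subset ?_
    intro u hu
    obtain ⟨k, hk⟩ := key u hu
    refine ⟨_, ⟨k, rfl⟩, ?_⟩
    simp only
    rw [hk, add_sub_cancel_left, smul_smul, inv_mul_cancel₀ hw.ne', one_smul]

/-- The walk pauses at `k`, so the normals of index `k` and `k + 1` belong to the same point. -/
theorem walk_mem_corners (hn : n ≠ 0) (hg : IsBalanced n g) {k : ℕ} (hk : g k = false) :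
    walk n g k ∈ corners (walkHull n g) := by
  have hw := walkWidth_pos hn
  have key : ∀ j, ∀ y ∈ walkHull n g, inner ℝ (walkNormal n j) (y - walk n g j) ≤ 0 := by
    intro j y hy
    have h1 := hg.inner_walkNormal_le hn hy j
    by_contra! h2
    nlinarith [mul_pos hw h2, sq_nonneg ‖y - walk n g j‖]
  refine ⟨hg.walk_mem_walkHull hn k, walkNormal n k, ⟨norm_walkNormal hn k, key k⟩,
    walkNormal n (k + 1), ⟨norm_walkNormal hn _, ?_⟩, ?_⟩
  · have := key (k + 1)
    rwa [walk_succ, hk, if_neg Bool.false_ne_true, add_zero] at this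
  · rw [walkNormal_succ]
    have h0 : walkNormal n k ≠ 0 := by
      rw [← norm_ne_zero_iff, norm_walkNormal hn]; exact one_ne_zero
    exact fun h => zeta_ne_one hn (mul_right_cancel₀ h0 (by rw [one_mul]; exact h.symm))

theorem corners_eq (hn : 2 ≤ n) (hg : IsBalanced n g) :
    corners (walkHull n g) = {x | ∃ k, g k = false ∧ x = walk n g k} := by
  refine Set.Subset.antisymm (fun x hx => hg.corners_subset hn hx) ?_
  rintro _ ⟨k, hk, rfl⟩
  exact hg.walk_mem_corners (by omega) hk

theorem walk_mem_frontier (hn : n ≠ 0) (hg : IsBalanced n g) (k : ℕ) :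
    walk n g k ∈ frontier (walkHull n g) := by
  have hw := walkWidth_pos hn
  refine ⟨subset_closure (hg.walk_mem_walkHull hn k), fun h => ?_⟩
  have h1 : walkHull n g ⊆ Metric.closedBall (walk n g (k + n)) (walkWidth n) :=
    Set.iInter_subset _ _
  have h2 := interior_mono h1 h
  rw [interior_closedBall _ hw.ne', Metric.mem_ball, dist_eq_norm,
    hg.walk_eq_add_normal hn k, add_sub_cancel_left, norm_smul, norm_walkNormal hn,
    Real.norm_of_nonneg hw.le, mul_one] at h2
  exact lt_irrefl _ h2

end IsBalanced

/-! ### The equilateral polygon of a balanced walk -/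

theorem apply_finRotate {α : Type*} {n : ℕ} (f : ℕ → α) (h : f n = f 0) (i : Fin n) :
    f (finRotate n i) = f (i + 1) := by
  obtain _ | n := n
  · exact i.elim0
  · rw [coe_finRotate]
    split_ifs with hi
    · rw [hi, Fin.val_last, h]
    · rfl

/-- The position of the `i`-th `true` in the sequence `g`. -/
noncomputable def edgeIndex (g : ℕ → Bool) (i : ℕ) : ℕ := Nat.nth (fun k => g k = true) i

/-- The polygon whose sides are the nonzero steps of a walk. -/
noncomputable def walkPolygon (n : ℕ) (g : ℕ → Bool) : Polygon ℂ n :=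
  ⟨fun i => walk n g (edgeIndex g i)⟩

theorem im_conj_zeta_pow_mul (n t l : ℕ) :
    ((starRingEnd ℂ) (zeta n ^ t) * zeta n ^ l).im = Real.sin ((l - t : ℝ) * (π / n)) := by
  rw [zeta_pow, zeta_pow, ← exp_conj, ← exp_add, map_mul, conj_I, conj_ofReal,
    ← exp_ofReal_mul_I_im]
  congr 2
  push_cast
  ring

namespace IsBalanced

variable {n : ℕ} {g : ℕ → Bool}

theorem infinite_true (hg : IsBalanced n g) :
    (Set.ofPred fun k => g k = true).Infinite := by
  rw [Set.infinite_iff_exists_gt]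
  intro a
  cases h : g (a + 1) with
  | true => exact ⟨a + 1, h, by omega⟩
  | false =>
    refine ⟨a + 1 + n, ?_, by omega⟩
    change g _ = true
    rw [hg.antiperiodic, h]; rfl

theorem edgeIndex_true (hg : IsBalanced n g) (i : ℕ) : g (edgeIndex g i) = true :=
  Nat.nth_mem_of_infinite (hg.infinite_true) i

theorem edgeIndex_strictMono (hg : IsBalanced n g) : StrictMono (edgeIndex g) :=
  Nat.nth_strictMono (hg.infinite_true)

theorem count_two_mul (hg : IsBalanced n g) : Nat.count (fun k => g k = true) (2 * n) = n := by
  rw [two_mul, Nat.count_add]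
  have h : (fun k => g (n + k) = true) = fun k => ¬ g k = true := by
    funext k
    rw [add_comm, hg.antiperiodic]
    cases g k <;> simp
  simp only [Nat.count_eq_card_filter_range]
  have := card_filter_add_card_filter_not (s := range n) (fun k => g k = true)
  rw [card_range] at this
  convert this using 3
  ext k
  simp only [mem_filter]
  rw [congrFun h k]

theorem edgeIndex_add (hg : IsBalanced n g) (i : ℕ) :
    edgeIndex g (i + n) = edgeIndex g i + 2 * n := by
  have h1 : Nat.count (fun k => g k = true) (2 * n + edgeIndex g i) = i + n := by
    rw [Nat.count_add, hg.count_two_mul]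
    have h : (fun k => g (2 * n + k) = true) = fun k => g k = true := by
      funext k
      rw [add_comm, hg.seq_add_two]
    simp only [h, edgeIndex]
    rw [Nat.count_nth_of_infinite (hg.infinite_true), add_comm]
  have h2 : g (2 * n + edgeIndex g i) = true := by
    rw [add_comm, hg.seq_add_two, hg.edgeIndex_true]
  rw [edgeIndex, ← h1, Nat.nth_count (p := fun k => g k = true) h2, add_comm]

theorem walk_edgeIndex_succ (hg : IsBalanced n g) (i : ℕ) :
    walk n g (edgeIndex g (i + 1)) = walk n g (edgeIndex g i) + zeta n ^ edgeIndex g i := by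
  have h1 : edgeIndex g i + 1 ≤ edgeIndex g (i + 1) :=
    hg.edgeIndex_strictMono (Nat.lt_succ_self i)
  have h2 := walk_sub_walk n g h1
  rw [Finset.sum_eq_zero, sub_eq_zero, walk_succ, hg.edgeIndex_true, if_pos rfl] at h2
  · exact h2
  · intro k hk
    rw [mem_Ico] at hk
    refine if_neg fun hgk => ?_
    have : k ≤ edgeIndex g i := Nat.le_nth_of_lt_nth_succ (p := fun k => g k = true) hk.2 hgk
    omega

theorem walkPolygon_finRotate (hg : IsBalanced n g) (hn : n ≠ 0) (i : Fin n) :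
    walkPolygon n g (finRotate n i) = walkPolygon n g i + zeta n ^ edgeIndex g i := by
  refine (apply_finRotate (fun i => walk n g (edgeIndex g i)) ?_ i).trans
    (hg.walk_edgeIndex_succ i)
  have := hg.edgeIndex_add 0
  rw [zero_add] at this
  simp only [this, hg.walk_add_two hn]

theorem isEquilateral (hg : IsBalanced n g) (hn : n ≠ 0) : IsEquilateral (walkPolygon n g) := by
  intro i j
  simp only [hg.walkPolygon_finRotate hn, dist_self_add_right, norm_zeta_pow]

/-- Seen from side `i`, steps within the next half turn go left and later ones go right. A vertex
reached after more than half a turn is measured backwards, through the remaining steps of the closed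
walk. -/
theorem im_conj_mul_walk_pos (hg : IsBalanced n g) (hn : n ≠ 0) {i j : ℕ} (h1 : i + 1 < j)
    (h2 : j < i + n) :
    0 < ((starRingEnd ℂ) (zeta n ^ edgeIndex g i) *
      (walk n g (edgeIndex g j) - walk n g (edgeIndex g i))).im := by
  have hmono := hg.edgeIndex_strictMono
  have e1 : edgeIndex g i < edgeIndex g (i + 1) := hmono (Nat.lt_succ_self i)
  have e2 := hmono h1
  have e3 := hmono h2
  rw [hg.edgeIndex_add] at e3
  have hnr : (0 : ℝ) < n := by positivity
  have hδ : 0 < π / n := div_pos Real.pi_pos hnr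
  have hδn : n * (π / n) = π := mul_div_cancel₀ _ hnr.ne'
  set t := edgeIndex g i
  have hsum : ∀ s : Finset ℕ, ((starRingEnd ℂ) (zeta n ^ t) *
      ∑ l ∈ s, if g l then zeta n ^ l else 0).im =
      ∑ l ∈ s, if g l then Real.sin ((l - t : ℝ) * (π / n)) else 0 := by
    intro s
    rw [mul_sum, im_sum]
    refine sum_congr rfl fun l _ => ?_
    rw [← im_conj_zeta_pow_mul]
    split_ifs <;> simp
  rcases le_or_gt (edgeIndex g j) (t + n) with h | h
  · rw [walk_sub_walk n g (by omega), hsum]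
    refine sum_pos' (fun l hl => ?_) ⟨edgeIndex g (i + 1), mem_Ico.2 ⟨by omega, e2⟩, ?_⟩
    · rw [mem_Ico] at hl
      split_ifs
      · have h3 : (t : ℝ) ≤ l := by exact_mod_cast hl.1
        have h4 : (l : ℝ) ≤ t + n := by exact_mod_cast (by omega : l ≤ t + n)
        have h5 : (l - t : ℝ) ≤ n := by linarith
        exact Real.sin_nonneg_of_nonneg_of_le_pi (mul_nonneg (by linarith) hδ.le)
          ((mul_le_mul_of_nonneg_right h5 hδ.le).trans_eq hδn)
      · exact le_rfl
    · rw [hg.edgeIndex_true, if_pos rfl]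
      have h3 : (t : ℝ) < edgeIndex g (i + 1) := by exact_mod_cast e1
      have h4 : (edgeIndex g (i + 1) : ℝ) < t + n := by
        exact_mod_cast (by omega : edgeIndex g (i + 1) < t + n)
      have h5 : (edgeIndex g (i + 1) - t : ℝ) < n := by linarith
      exact Real.sin_pos_of_pos_of_lt_pi (mul_pos (by linarith) hδ)
        ((mul_lt_mul_of_pos_right h5 hδ).trans_eq hδn)
  · rw [← hg.walk_add_two hn t, ← neg_sub, walk_sub_walk n g e3.le, mul_neg, neg_im, hsum,
      ← sum_neg_distrib]
    have hneg : ∀ l ∈ Ico (edgeIndex g j) (t + 2 * n),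
        Real.sin ((l - t : ℝ) * (π / n)) < 0 := by
      intro l hl
      rw [mem_Ico] at hl
      have h3 : (t : ℝ) + n < l := by exact_mod_cast (by omega : t + n < l)
      have h4 : (l : ℝ) < t + 2 * n := by exact_mod_cast hl.2
      rw [← Real.sin_sub_two_pi]
      have h5 := mul_lt_mul_of_pos_right h3 hδ
      have h6 := mul_lt_mul_of_pos_right h4 hδ
      refine Real.sin_neg_of_neg_of_neg_pi_lt ?_ ?_ <;> linarith
    refine sum_pos' (fun l hl => ?_) ⟨edgeIndex g j, left_mem_Ico.2 e3, ?_⟩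
    · have := hneg l hl
      split_ifs <;> linarith
    · rw [hg.edgeIndex_true, if_pos rfl]
      exact neg_pos.2 (hneg _ (left_mem_Ico.2 e3))

theorem isConvexPolygon (hg : IsBalanced n g) (hn : 3 ≤ n) :
    IsConvexPolygon (walkPolygon n g) := by
  have hn0 : n ≠ 0 := by omega
  refine ⟨hn, fun i j hij hij' => ?_⟩
  rw [hg.walkPolygon_finRotate hn0, add_sub_cancel_left]
  have hval : (j : ℕ) ≠ i := fun h => hij (Fin.ext h)
  have hi := i.isLt
  have hj := j.isLt
  have hne : ∀ a : ℕ, (i : ℕ) + 1 = a → a % n ≠ j := by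
    rintro _ rfl h
    refine hij' (Fin.ext ?_)
    rw [← h, apply_finRotate (fun k => k % n) (by simp) i |>.symm, Nat.mod_eq_of_lt (Fin.isLt _)]
  rcases lt_or_gt_of_ne hval with h | h
  · have hpos := hg.im_conj_mul_walk_pos hn0 (i := i) (j := j + n) (by
      have := hne (j + n)
      rw [Nat.add_mod_right, Nat.mod_eq_of_lt hj] at this
      by_contra! h'
      exact this (by omega) rfl) (by omega)
    rwa [hg.edgeIndex_add, hg.walk_add_two hn0] at hpos
  · exact hg.im_conj_mul_walk_pos hn0 (i := i) (j := j) (by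
      have := hne j
      rw [Nat.mod_eq_of_lt hj] at this
      by_contra! h'
      exact this (by omega) rfl) (by omega)

theorem walkPolygon_injective (hg : IsBalanced n g) (hn : 3 ≤ n) :
    Function.Injective (walkPolygon n g).vertices := by
  have hn0 : n ≠ 0 := by omega
  intro i j h
  by_contra hij
  by_cases hij' : j = finRotate n i
  · rw [hij', hg.walkPolygon_finRotate hn0, left_eq_add] at h
    exact zeta_pow_ne_zero _ _ h
  · have := (hg.isConvexPolygon hn).2 i j (Ne.symm hij) hij'
    rw [h, sub_self, mul_zero] at this
    exact lt_irrefl _ this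

theorem exists_edgeIndex_eq (hg : IsBalanced n g) (hn : n ≠ 0) {t : ℕ} (ht : g t = true) :
    ∃ i : Fin n, edgeIndex g i = t % (2 * n) := by
  have h1 : g (t % (2 * n)) = true := by
    rw [← ht]
    conv_rhs => rw [← Nat.mod_add_div t (2 * n)]
    generalize t / (2 * n) = m
    generalize t % (2 * n) = a
    induction m with
    | zero => rfl
    | succ m ih => rw [mul_add, mul_one, ← add_assoc, hg.seq_add_two, ih]
  have h2 : Nat.count (fun k => g k = true) (t % (2 * n)) < n := by
    have h3 := Nat.mod_lt t (show 2 * n > 0 by omega)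
    have h4 := Nat.count_strict_mono (p := fun k => g k = true) h1 h3
    rwa [hg.count_two_mul] at h4
  exact ⟨⟨_, h2⟩, Nat.nth_count (p := fun k => g k = true) h1⟩

theorem walk_mem_range (hg : IsBalanced n g) (hn : n ≠ 0) (k : ℕ) :
    walk n g k ∈ Set.range (walkPolygon n g).vertices := by
  induction k with
  | zero =>
    refine ⟨⟨0, by omega⟩, ?_⟩
    simp only [walkPolygon, walk, range_zero, sum_empty]
    refine Finset.sum_eq_zero fun k hk => if_neg fun h => ?_
    have h1 := Nat.nth_count (p := fun k => g k = true) h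
    have h2 := hg.edgeIndex_strictMono.monotone (Nat.zero_le (Nat.count (fun k => g k = true) k))
    exact (mem_range.1 hk).not_ge (h2.trans_eq h1)
  | succ k ih =>
    rw [walk_succ]
    split_ifs with h
    · obtain ⟨i, hi⟩ := hg.exists_edgeIndex_eq hn h
      refine ⟨finRotate n i, ?_⟩
      rw [hg.walkPolygon_finRotate hn]
      simp only [walkPolygon, hi]
      rw [hg.walk_mod hn]
      congr 1
      conv_rhs => rw [← Nat.mod_add_div k (2 * n), pow_add, pow_mul, mul_comm 2 n, pow_mul,
        zeta_pow_self hn]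
      rw [mul_comm 2 n]
      simp
    · simpa using ih

/-- Used to show that the star polygon visits no corner twice: a corner determines the side that
arrives there. -/
theorem walk_succ_eq_walk_succ (hg : IsBalanced n g) (hn : 3 ≤ n) {s t : ℕ} (hs : g s = true)
    (ht : g t = true) (h : walk n g (s + 1) = walk n g (t + 1)) : s ≡ t [MOD 2 * n] := by
  have hn0 : n ≠ 0 := by omega
  have key : ∀ s, g s = true → ∃ i : Fin n, edgeIndex g i = s % (2 * n) ∧
      walkPolygon n g (finRotate n i) = walk n g (s + 1) := by
    intro s hs
    obtain ⟨i, hi⟩ := hg.exists_edgeIndex_eq hn0 hs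
    refine ⟨i, hi, ?_⟩
    rw [hg.walkPolygon_finRotate hn0, walk_succ, hs, if_pos rfl]
    simp only [walkPolygon, hi]
    rw [hg.walk_mod hn0]
    congr 1
    conv_rhs => rw [← Nat.mod_add_div s (2 * n), pow_add, pow_mul, mul_comm 2 n, pow_mul,
      zeta_pow_self hn0]
    rw [mul_comm 2 n]
    simp
  obtain ⟨i, hi, hi'⟩ := key s hs
  obtain ⟨j, hj, hj'⟩ := key t ht
  have := hg.walkPolygon_injective hn (hi'.trans (h.trans hj'.symm))
  rw [(finRotate n).injective this] at hi
  exact hi.symm.trans hj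

theorem isReinhardtIn (hg : IsBalanced n g) (hn : 3 ≤ n) :
    IsReinhardtIn (walkPolygon n g) (walkHull n g) (walkWidth n) where
  convex := hg.isConvexPolygon hn
  equilateral := hg.isEquilateral (by omega)
  reuleaux := hg.isReuleauxPolygon (by omega)
  inscribed i := hg.walk_mem_frontier (by omega) _
  corners_subset := by
    rw [hg.corners_eq (by omega)]
    rintro _ ⟨k, -, rfl⟩
    exact hg.walk_mem_range (by omega) k

end IsBalanced

/-! ### The star polygon of a balanced walk -/

/-- The runs of the sequence `g` on `[0, n)` have the lengths given by `c`, the first one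
consisting of `false`. -/
def IsRunLength {n : ℕ} (c : Composition n) (g : ℕ → Bool) : Prop :=
  ∀ i < c.length, ∀ k, c.sizeUpTo i ≤ k → k < c.sizeUpTo (i + 1) → g k = decide (Odd i)

/-- The polygon that visits the corners of the region spanned by a walk, in the order of
the corresponding runs. -/
noncomputable def walkStar {n : ℕ} (c : Composition n) (g : ℕ → Bool) : Polygon ℂ c.length :=
  ⟨fun i => walk n g (c.sizeUpTo i + i * n)⟩

theorem decide_odd_succ (m : ℕ) : decide (Odd (m + 1)) = !decide (Odd m) := by
  rw [← decide_not, decide_eq_decide, Nat.odd_add_one]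

theorem antiperiodic_mul_odd {b : ℕ → Bool} {d : ℕ} (hb : ∀ i, b (i + d) = !b i) (i s : ℕ) :
    b (i + s * d) = Bool.xor (b i) (decide (Odd s)) := by
  induction s with
  | zero => simp
  | succ s ih =>
    rw [add_mul, one_mul, ← add_assoc, hb, ih, decide_odd_succ, Bool.xor_not]

theorem angle_exp_exp_of_le {s t : ℝ} (h0 : s ≤ t) (h1 : t - s ≤ π) :
    InnerProductGeometry.angle (exp (s * I)) (exp (t * I)) = t - s := by
  rw [InnerProductGeometry.angle, inner_exp_exp, norm_exp_ofReal_mul_I, norm_exp_ofReal_mul_I,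
    mul_one, div_one, Real.arccos_cos (sub_nonneg.2 h0) h1]

theorem angle_walkNormal {n : ℕ} (hn : n ≠ 0) (a : ℕ) {m : ℕ} (hm : m ≤ n) :
    InnerProductGeometry.angle (walkNormal n a) (walkNormal n (a + m)) = m * (π / n) := by
  have hnr : (0 : ℝ) < n := by positivity
  have hδ : 0 < π / n := div_pos Real.pi_pos hnr
  have hδn : n * (π / n) = π := mul_div_cancel₀ _ hnr.ne'
  have hm' : (m : ℝ) ≤ n := by exact_mod_cast hm
  have h0 : (-(1 - zeta n)⁻¹ / walkWidth n) ≠ 0 := by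
    have h := norm_walkNormal hn 0
    rw [walkNormal, pow_zero, one_mul] at h
    rw [← norm_ne_zero_iff, h]
    exact one_ne_zero
  have e : ((a + m : ℕ) : ℝ) * (π / n) - a * (π / n) = m * (π / n) := by push_cast; ring
  have e0 : 0 ≤ m * (π / n) := by positivity
  rw [walkNormal, walkNormal, mul_comm, mul_comm _ (-(1 - zeta n)⁻¹ / (walkWidth n : ℂ)),
    angle_mul_left h0, zeta_pow, zeta_pow, angle_exp_exp_of_le (by linarith), e]
  rw [e]
  exact (mul_le_mul_of_nonneg_right hm' hδ.le).trans_eq hδn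

theorem walkNormal_add_mul {n : ℕ} (hn : n ≠ 0) (k m : ℕ) :
    walkNormal n (k + m * n) = (-1) ^ m * walkNormal n k := by
  induction m with
  | zero => simp
  | succ m ih => rw [add_mul, one_mul, ← add_assoc, walkNormal_add_self hn, ih, pow_succ]; ring

theorem exists_sizeUpTo_le_lt {n : ℕ} (c : Composition n) {k : ℕ} (hk : k < n) :
    ∃ i < c.length, c.sizeUpTo i ≤ k ∧ k < c.sizeUpTo (i + 1) :=
  ⟨c.index ⟨k, hk⟩, Fin.isLt _, c.sizeUpTo_index_le ⟨k, hk⟩, c.lt_sizeUpTo_index_succ ⟨k, hk⟩⟩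

theorem sizeUpTo_injOn {n : ℕ} (c : Composition n) {i j : ℕ} (hi : i < c.length)
    (hj : j < c.length) (h : c.sizeUpTo i = c.sizeUpTo j) : i = j := by
  rcases lt_trichotomy i j with hij | hij | hij
  · have h1 := c.sizeUpTo_strict_mono hi
    have h2 := c.monotone_sizeUpTo (show i + 1 ≤ j from hij)
    omega
  · exact hij
  · have h1 := c.sizeUpTo_strict_mono hj
    have h2 := c.monotone_sizeUpTo (show j + 1 ≤ i from hij)
    omega

namespace IsBalanced

variable {n : ℕ} {g : ℕ → Bool}

theorem seq_add_mul (hg : IsBalanced n g) (k m : ℕ) :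
    g (k + m * n) = Bool.xor (g k) (decide (Odd m)) :=
  antiperiodic_mul_odd hg.antiperiodic k m

theorem walk_add_mul_parity (hn : n ≠ 0) (hg : IsBalanced n g) (k m : ℕ) :
    walk n g (k + m * n) = walk n g (k + m % 2 * n) := by
  conv_lhs => rw [← Nat.mod_add_div m 2]
  rw [← hg.walk_add_mul hn (k + m % 2 * n) (m / 2)]
  congr 1
  ring

theorem walk_eq_of_false {a b : ℕ} (hab : a ≤ b) (h : ∀ l, a ≤ l → l < b → g l = false) :
    walk n g b = walk n g a := by
  rw [← sub_eq_zero, walk_sub_walk n g hab]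
  refine Finset.sum_eq_zero fun l hl => ?_
  rw [mem_Ico] at hl
  rw [h l hl.1 hl.2, if_neg Bool.false_ne_true]

variable {c : Composition n}

/-- Run `i` carries the parity of `i`; moving it by `i` half periods makes it a pause, hence the
offset `i * n` in `walkStar`. -/
theorem seq_run (hg : IsBalanced n g) (hc : IsRunLength c g) {i : ℕ} (hi : i < c.length) {l : ℕ}
    (h1 : c.sizeUpTo i + i * n ≤ l) (h2 : l < c.sizeUpTo (i + 1) + i * n) : g l = false := by
  obtain ⟨k, rfl⟩ : ∃ k, l = k + i * n := ⟨l - i * n, by omega⟩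
  rw [hg.seq_add_mul, hc i hi k (by omega) (by omega), Bool.xor_self]

theorem seq_before_run (hg : IsBalanced n g) (hc : IsRunLength c g) (hodd : Odd c.length) {i : ℕ}
    (hi : i < c.length) :
    ∃ t, t + 1 = c.sizeUpTo i + i * n + 2 * n ∧ g t = true := by
  rcases i with _ | i
  -- Before run `0` comes the antipode of the last run, which consists of `false` since the number
  -- of runs is odd. The extra `2 * n` avoids a negative index.
  · have hl : c.length - 1 + 1 = c.length := by omega
    have h1 := c.sizeUpTo_strict_mono (show c.length - 1 < c.length by omega)
    rw [hl, c.sizeUpTo_length] at h1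
    have h2 := hc (c.length - 1) (by omega) (n - 1) (by omega) (by
      rw [hl, c.sizeUpTo_length]; omega)
    have h3 : ¬ Odd (c.length - 1) := by
      obtain ⟨m, hm⟩ := hodd
      rw [hm, Nat.add_sub_cancel]
      simp
    refine ⟨n - 1 + n, by rw [c.sizeUpTo_zero]; omega, ?_⟩
    rw [hg.antiperiodic, h2]
    simp [h3]
  · have h1 := c.sizeUpTo_strict_mono (show i < c.length by omega)
    have h2 := hc i (by omega) (c.sizeUpTo (i + 1) - 1) (by omega) (by omega)
    refine ⟨c.sizeUpTo (i + 1) - 1 + (i + 1) * n + 2 * n, by omega, ?_⟩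
    rw [hg.seq_add_two, hg.seq_add_mul, h2, decide_odd_succ, Bool.xor_not,
      Bool.xor_self, Bool.not_false]

theorem walk_sizeUpTo_succ (hg : IsBalanced n g) (hc : IsRunLength c g) {i : ℕ}
    (hi : i < c.length) :
    walk n g (c.sizeUpTo (i + 1) + i * n) = walk n g (c.sizeUpTo i + i * n) :=
  walk_eq_of_false (Nat.add_le_add_right (c.monotone_sizeUpTo (Nat.le_succ i)) _)
    fun _ h1 h2 => hg.seq_run hc hi h1 h2

theorem walkStar_sub_walkStar (hn : n ≠ 0) (hg : IsBalanced n g) (hc : IsRunLength c g)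
    (hodd : Odd c.length) (i : Fin c.length) :
    walkStar c g i - walkStar c g (finRotate _ i) =
      walkWidth n • walkNormal n (c.sizeUpTo (i + 1) + i * n) := by
  have h1 : walkStar c g (finRotate _ i) =
      walk n g (c.sizeUpTo (i + 1) + (i + 1) * n) := by
    have := apply_finRotate (fun j => walk n g (c.sizeUpTo j + j * n)) (by
      rw [c.sizeUpTo_length, c.sizeUpTo_zero, hg.walk_add_mul_parity hn, Nat.odd_iff.1 hodd,
        ← hg.walk_add_two hn (0 + 0 * n)]
      congr 1
      ring) i
    exact this
  rw [h1, walkStar]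
  simp only
  rw [← hg.walk_sizeUpTo_succ hc i.isLt, hg.walk_eq_add_normal hn, add_mul, one_mul, ← add_assoc,
    add_sub_cancel_left]

theorem isStarPolygon (hn : 3 ≤ n) (hg : IsBalanced n g) (hc : IsRunLength c g)
    (hodd : Odd c.length) : IsStarPolygon (walkStar c g) (walkHull n g) (walkWidth n) := by
  have hn0 : n ≠ 0 := by omega
  refine ⟨fun i j h => ?_, ?_, fun i => ?_⟩
  · obtain ⟨s, hs, hs'⟩ := hg.seq_before_run hc hodd i.isLt
    obtain ⟨t, ht, ht'⟩ := hg.seq_before_run hc hodd j.isLt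
    have h1 : walk n g (s + 1) = walk n g (t + 1) := by
      rw [hs, ht, hg.walk_add_two hn0, hg.walk_add_two hn0]; exact h
    have h2 : s + 1 ≡ t + 1 [MOD n] :=
      ((hg.walk_succ_eq_walk_succ hn hs' ht' h1).of_mul_left 2).add_right 1
    have h3 : c.sizeUpTo i ≡ c.sizeUpTo j [MOD n] := by
      have key : ∀ a b : ℕ, a + b * n + 2 * n ≡ a [MOD n] := fun a b => by
        rw [add_assoc, ← add_mul]; simp [Nat.ModEq]
      rw [hs, ht] at h2
      exact (key _ _).symm.trans (h2.trans (key _ _))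
    have lt : ∀ i : Fin c.length, c.sizeUpTo i < n := fun i =>
      (c.sizeUpTo_strict_mono i.isLt).trans_le (c.sizeUpTo_le _)
    exact Fin.ext (sizeUpTo_injOn c i.isLt j.isLt (h3.eq_of_lt_of_lt (lt i) (lt j)))
  · rw [hg.corners_eq (by omega)]
    refine Set.Subset.antisymm ?_ ?_
    · rintro _ ⟨i, rfl⟩
      exact ⟨_, hg.seq_run hc i.isLt le_rfl
        (Nat.add_lt_add_right (c.sizeUpTo_strict_mono i.isLt) _), rfl⟩
    · rintro _ ⟨k, hk, rfl⟩
      obtain ⟨i, hi, h1, h2⟩ := exists_sizeUpTo_le_lt c (Nat.mod_lt k (Nat.pos_of_ne_zero hn0))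
      refine ⟨⟨i, hi⟩, ?_⟩
      have hkm : k = k % n + k / n * n := by rw [mul_comm]; exact (Nat.mod_add_div k n).symm
      have h3 := hk
      rw [hkm, hg.seq_add_mul, hc i hi _ h1 h2] at h3
      have h4 : i % 2 = k / n % 2 := by
        have h5 : Odd i ↔ Odd (k / n) := by simpa using h3
        rw [Nat.odd_iff, Nat.odd_iff] at h5
        omega
      have h5 : walk n g (k % n + i * n) = walk n g (c.sizeUpTo i + i * n) :=
        walk_eq_of_false (Nat.add_le_add_right h1 _)
          fun l hl hl' => hg.seq_run hc hi hl (by omega)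
      rw [hkm, hg.walk_add_mul_parity hn0, ← h4, ← hg.walk_add_mul_parity hn0, h5]
      rfl
  · rw [dist_eq_norm, hg.walkStar_sub_walkStar hn0 hc hodd, norm_smul, norm_walkNormal hn0,
      Real.norm_of_nonneg (walkWidth_pos hn0).le, mul_one]

theorem angle_walkStar (hn : n ≠ 0) (hg : IsBalanced n g) (hc : IsRunLength c g)
    (hodd : Odd c.length) (i : Fin c.length) :
    EuclideanGeometry.angle (walkStar c g i) (walkStar c g (finRotate _ i))
      (walkStar c g (finRotate _ (finRotate _ i))) =
        c.blocksFun (finRotate _ i) * (π / n) := by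
  have h1 := hg.walkStar_sub_walkStar hn hc hodd i
  have h2 := hg.walkStar_sub_walkStar hn hc hodd (finRotate _ i)
  -- Both edges at the corner are now expressed by normals whose indices differ by the length of its
  -- run. Closing up at the last index uses the odd number of runs.
  have h3 : walkNormal n (c.sizeUpTo (i + 1) + i * n) =
      -walkNormal n (c.sizeUpTo (finRotate _ i) + (finRotate _ i : ℕ) * n) := by
    have := apply_finRotate (fun j => walkNormal n (c.sizeUpTo j + j * n)) (by
      rw [c.sizeUpTo_length, c.sizeUpTo_zero, add_comm, ← zero_add (c.length * n), add_assoc,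
        add_comm _ n, ← one_add_mul, walkNormal_add_mul hn, zero_mul, add_zero]
      rw [show (-1 : ℂ) ^ (1 + c.length) = 1 from
        ((odd_one.add_odd hodd)).neg_one_pow, one_mul]) i
    rw [this, add_mul, one_mul, ← add_assoc, walkNormal_add_self hn, neg_neg]
  have hw := walkWidth_pos hn
  rw [EuclideanGeometry.angle, vsub_eq_sub, vsub_eq_sub, h1,
    ← neg_sub (walkStar c g (finRotate _ i)), h2, h3, ← smul_neg,
    InnerProductGeometry.angle_smul_left_of_pos _ _ hw,
    InnerProductGeometry.angle_smul_right_of_pos _ _ hw, InnerProductGeometry.angle_neg_neg,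
    c.sizeUpTo_succ', add_right_comm, angle_walkNormal hn]
  have h4 := c.sizeUpTo_succ' (finRotate _ i)
  have h5 := c.sizeUpTo_le ((finRotate _ i : ℕ) + 1)
  omega

theorem mk_mem_reinhardtClasses (hn : 3 ≤ n) (hg : IsBalanced n g)
    (c : {c : Composition n // Odd c.length}) (hc : IsRunLength c.1 g) :
    Quotient.mk (dihedralSetoid n) c ∈ reinhardtClasses n := by
  have hP := hg.isReinhardtIn hn
  exact ⟨walkPolygon n g, ⟨_, _, hP⟩, c, ⟨_, _, hP, walkStar c.1 g,
    hg.isStarPolygon hn hc c.2, hg.angle_walkStar (by omega) hc c.2⟩, rfl⟩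

end IsBalanced

end Geometry

/-! ### Counting classes, and the density of the exceptional integers. -/

section Counting

open Finset Filter Topology

/-! ### Counting dihedral compositions -/

/-- The version of `IsRunLength` for lists of block lengths. -/
def IsRunList (L : List ℕ) (g : ℕ → Bool) : Prop :=
  ∀ i < L.length, ∀ k, (L.take i).sum ≤ k → k < (L.take (i + 1)).sum → g k = decide (Odd i)

theorem isRunList_concat {L : List ℕ} {x : ℕ} {g : ℕ → Bool} :
    IsRunList (L ++ [x]) g ↔ IsRunList L g ∧
      ∀ k, L.sum ≤ k → k < L.sum + x → g k = decide (Odd L.length) := by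
  have h1 : ∀ i ≤ L.length, (L ++ [x]).take i = L.take i := fun i hi =>
    List.take_append_of_le_length hi
  have h2 : (L ++ [x]).take (L.length + 1) = L ++ [x] :=
    List.take_of_length_le (by simp)
  constructor
  · intro h
    refine ⟨fun i hi => ?_, fun k hk hk' => ?_⟩
    · have := h i (by simp; omega)
      rwa [h1 _ hi.le, h1 _ hi] at this
    · have := h L.length (by simp) k
      rw [h1 _ le_rfl, h2, List.take_length, List.sum_append, List.sum_singleton] at this
      exact this hk hk'
  · rintro ⟨h, h'⟩ i hi
    rw [List.length_append, List.length_singleton, Nat.lt_succ_iff_lt_or_eq] at hi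
    rcases hi with hi | rfl
    · rw [h1 _ hi.le, h1 _ hi]
      exact h i hi
    · rw [h1 _ le_rfl, h2, List.take_length, List.sum_append, List.sum_singleton]
      exact h'

theorem exists_isRunList {g : ℕ → Bool} (h0 : g 0 = false) {n : ℕ} (hn : 1 ≤ n) :
    ∃ (L : List ℕ) (x : ℕ), (∀ y ∈ L, 0 < y) ∧ 0 < x ∧ L.sum + x = n ∧
      IsRunList (L ++ [x]) g := by
  induction n, hn using Nat.le_induction with
  | base =>
    refine ⟨[], 1, by simp, one_pos, rfl, isRunList_concat.2 ⟨fun i hi => ?_, fun k _ hk => ?_⟩⟩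
    · simp at hi
    · simp only [List.sum_nil, zero_add, Nat.lt_one_iff] at hk
      simp [hk, h0]
  | succ n _ ih =>
    obtain ⟨L, x, hL, hx, hs, hrun⟩ := ih
    have hrun' := isRunList_concat.1 hrun
    by_cases h : g n = decide (Odd L.length)
    · refine ⟨L, x + 1, hL, Nat.succ_pos x, by omega, isRunList_concat.2 ⟨hrun'.1, ?_⟩⟩
      intro k h1 h2
      rcases eq_or_ne k n with rfl | hk
      · exact h
      · exact hrun'.2 k h1 (by omega)
    · refine ⟨L ++ [x], 1, ?_, one_pos, by simp [hs], isRunList_concat.2 ⟨hrun, ?_⟩⟩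
      · intro y hy
        rcases List.mem_append.1 hy with hy | hy
        · exact hL y hy
        · rwa [List.mem_singleton.1 hy]
      · intro k h1 h2
        obtain rfl : k = n := by
          rw [List.sum_append, List.sum_singleton, hs] at h1 h2; omega
        rw [List.length_append, List.length_singleton, decide_odd_succ]
        exact Bool.eq_not.2 h

theorem exists_isRunLength {g : ℕ → Bool} (h0 : g 0 = false) {n : ℕ} (hn : 1 ≤ n) :
    ∃ c : Composition n, IsRunLength c g := by
  obtain ⟨L, x, hL, hx, hs, hrun⟩ := exists_isRunList h0 hn
  refine ⟨⟨L ++ [x], fun {y} hy => ?_, by simp [hs]⟩, hrun⟩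
  rcases List.mem_append.1 hy with hy | hy
  · exact hL y hy
  · rwa [List.mem_singleton.1 hy]

theorem IsRunLength.eq_of_lt {n : ℕ} {c : Composition n} {g g' : ℕ → Bool} (h : IsRunLength c g)
    (h' : IsRunLength c g') {k : ℕ} (hk : k < n) : g k = g' k := by
  obtain ⟨i, hi, h1, h2⟩ := exists_sizeUpTo_le_lt c hk
  rw [h i hi k h1 h2, h' i hi k h1 h2]

theorem IsRunLength.odd_length {n : ℕ} (hn : 1 ≤ n) {c : Composition n} {g : ℕ → Bool}
    (h : IsRunLength c g) (hg : g (n - 1) = false) : Odd c.length := by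
  have h0 := c.length_pos_of_pos hn
  have hl : c.length - 1 + 1 = c.length := by omega
  have h1 := c.sizeUpTo_strict_mono (show c.length - 1 < c.length by omega)
  have h2 := h (c.length - 1) (by omega) (n - 1)
  rw [hl, c.sizeUpTo_length] at h1 h2
  have h3 := h2 (by omega) (by omega)
  rw [hg] at h3
  rw [← hl, Nat.odd_add_one]
  exact of_decide_eq_false h3.symm

instance (n : ℕ) : Finite (DihedralComposition n) :=
  inferInstanceAs (Finite (Quotient (dihedralSetoid n)))

/-- All members are rotations of one block list, or reversals of these. -/
theorem card_le_of_mk_eq {n : ℕ} (s : Finset {c : Composition n // Odd c.length})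
    (d : {c : Composition n // Odd c.length})
    (hs : ∀ c ∈ s, Quotient.mk (dihedralSetoid n) c = Quotient.mk (dihedralSetoid n) d) :
    s.card ≤ 2 * (n + 1) := by
  classical
  set L := (List.range (d.1.length + 1)).map d.1.blocks.rotate with hL
  have hinj : Set.InjOn (fun c : {c : Composition n // Odd c.length} => c.1.blocks) s :=
    fun c _ e _ h => Subtype.ext (Composition.ext h)
  have hsub : s.image (fun c => c.1.blocks) ⊆ (L ++ L.map List.reverse).toFinset := by
    intro b hb
    obtain ⟨c, hc, rfl⟩ := mem_image.1 hb
    rw [List.mem_toFinset, List.mem_append]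
    rcases Quotient.exact (hs c hc) with h | h
    · exact Or.inl (List.isRotated_iff_mem_map_range.1 h.symm)
    · refine Or.inr (List.mem_map.2 ⟨_, List.isRotated_iff_mem_map_range.1 h.symm, ?_⟩)
      rw [List.reverse_reverse]
  rw [← card_image_of_injOn hinj]
  refine (card_le_card hsub).trans ((List.toFinset_card_le _).trans ?_)
  have := d.1.length_le
  simp [hL]
  omega

/-- The value at `0` starts the run lengths with a run of `false`; the value at `n - 1` makes the
number of runs odd. -/
theorem card_le_mul_ncard_reinhardtClasses {n : ℕ} (hn : 3 ≤ n) {ι : Type*} [Fintype ι]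
    (g : ι → ℕ → Bool) (hg : ∀ i, IsBalanced n (g i)) (h0 : ∀ i, g i 0 = false)
    (h1 : ∀ i, g i (n - 1) = false) (hinj : ∀ i j, (∀ k < n, g i k = g j k) → i = j) :
    Fintype.card ι ≤ 2 * (n + 1) * (reinhardtClasses n).ncard := by
  classical
  have hc : ∀ i, ∃ c : {c : Composition n // Odd c.length}, IsRunLength c.1 (g i) := by
    intro i
    obtain ⟨c, hc⟩ := exists_isRunLength (h0 i) (show 1 ≤ n by omega)
    exact ⟨⟨c, hc.odd_length (by omega) (h1 i)⟩, hc⟩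
  choose c hc using hc
  have hcinj : Function.Injective c := by
    intro i j h
    refine hinj i j fun k hk => (hc i).eq_of_lt ?_ hk
    rw [h]
    exact hc j
  let f : {c : Composition n // Odd c.length} → DihedralComposition n := Quotient.mk _
  have h2 := card_le_mul_card_image (f := f) (univ.image c) (2 * (n + 1)) (by
    intro b hb
    obtain ⟨d, -, rfl⟩ := mem_image.1 hb
    exact card_le_of_mk_eq _ d fun e he => (mem_filter.1 he).2)
  rw [card_image_of_injective _ hcinj, card_univ] at h2
  refine h2.trans (Nat.mul_le_mul_left _ ?_)
  rw [← Set.ncard_coe_finset]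
  refine Set.ncard_le_ncard ?_ (Set.toFinite _)
  intro x hx
  obtain ⟨d, hd, rfl⟩ := mem_image.1 (mem_coe.1 hx)
  obtain ⟨i, -, rfl⟩ := mem_image.1 hd
  exact (hg i).mk_mem_reinhardtClasses hn (c i) (hc i)

theorem sum_two_pow_pred (N : ℕ) : ∑ m ∈ Icc 1 N, 2 ^ (m - 1) ≤ 2 ^ N := by
  have h : ∑ m ∈ Icc 1 N, 2 ^ (m - 1) + 1 = 2 ^ N := by
    induction N with
    | zero => simp
    | succ N ih =>
      rw [sum_Icc_succ_top (by omega), Nat.add_sub_cancel, pow_succ]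
      omega
  omega

theorem numPeriodic_le {n p : ℕ} (hn : 0 < n) (hp : 0 < p)
    (hmin : ∀ q, q.Prime → Odd q → q ∣ n → p ≤ q) : numPeriodic n ≤ 2 ^ (n / p) := by
  classical
  set T : Finset {c : Composition n // Odd c.length} :=
    univ.filter fun c => IsPeriodicComposition c.1 with hT
  have h1 : numPeriodic n ≤ T.card := by
    let f : {c : Composition n // Odd c.length} → DihedralComposition n := Quotient.mk _
    refine le_trans ?_ (card_image_le (s := T) (f := f))
    rw [numPeriodic, ← Set.ncard_coe_finset]
    refine Set.ncard_le_ncard ?_ (Set.toFinite _)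
    rintro x ⟨-, c, rfl, hc⟩
    exact mem_coe.2 (mem_image_of_mem f (mem_filter.2 ⟨mem_univ _, hc⟩))
  refine h1.trans ?_
  have hinj : Set.InjOn (fun c : {c : Composition n // Odd c.length} => c.1.blocks) T :=
    fun c _ e _ h => Subtype.ext (Composition.ext h)
  rw [← card_image_of_injOn hinj]
  have hsub : T.image (fun c => c.1.blocks) ⊆ (Icc 1 (n / p)).biUnion fun m =>
      (univ : Finset (Composition m)).image fun d =>
        (List.replicate (n / m) d.blocks).flatten := by
    intro b hb
    obtain ⟨c, hc, rfl⟩ := mem_image.1 hb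
    obtain ⟨m, ⟨e, rfl⟩, hmn, d, hd, hblocks⟩ := (mem_filter.1 hc).2
    have hm : 0 < m := Nat.pos_of_mul_pos_right hn
    rw [Nat.mul_div_cancel_left _ hm] at hblocks
    have hlen : Odd (e * d.length) := by
      have h2 := c.2
      rw [← c.1.blocks_length, hblocks] at h2
      simpa using h2
    -- The total number of parts is odd, so the number of repetitions is odd and has an odd prime
    -- factor of `n`.
    have he : Odd e := (Nat.odd_mul.1 hlen).1
    have he1 : e ≠ 1 := by rintro rfl; omega
    obtain ⟨q, hq, hqe⟩ := Nat.exists_prime_and_dvd he1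
    have hpe : p ≤ e := (hmin q hq (he.of_dvd_nat hqe) (hqe.mul_left m)).trans
      (Nat.le_of_dvd (Nat.pos_of_ne_zero (by rintro rfl; simp at hn)) hqe)
    refine mem_biUnion.2 ⟨m, mem_Icc.2 ⟨hm, ?_⟩, mem_image.2 ⟨d, mem_univ _, ?_⟩⟩
    · rw [Nat.le_div_iff_mul_le hp]
      exact Nat.mul_le_mul_left m hpe
    · rw [hblocks, Nat.mul_div_cancel_left _ hm]
  refine (card_le_card hsub).trans (card_biUnion_le.trans ?_)
  refine le_trans (sum_le_sum fun m _ => ?_) (sum_two_pow_pred (n / p))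
  refine card_image_le.trans ?_
  rw [card_univ, composition_card]

theorem numPeriodic_add_numSporadic (n : ℕ) :
    numPeriodic n + numSporadic n = (reinhardtClasses n).ncard :=
  Set.ncard_inter_add_ncard_sdiff_eq_ncard (reinhardtClasses n) {x | x.IsPeriodic} (Set.toFinite _)

/-! ### A family of balanced sequences -/

theorem sum_range_mul_eq {M : Type*} [AddCommMonoid M] (f : ℕ → M) (m r : ℕ) :
    ∑ k ∈ range (m * r), f k = ∑ i ∈ range m, ∑ j ∈ range r, f (i * r + j) := by
  induction m with
  | zero => simp
  | succ m ih => rw [add_mul, one_mul, sum_range_add, ih, sum_range_succ]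

/-- Blocks of length `d` form a geometric progression of ratio `-ω ^ d ≠ 1`, whose `e`-th power is
`1`. -/
theorem sum_antiperiodic_eq_zero {b : ℕ → Bool} {d e : ℕ} (hb : ∀ i, b (i + d) = !b i)
    (he : Odd e) {ω : ℂ} (h1 : ω ^ (e * d) = -1) (h2 : ω ^ d ≠ -1) :
    ∑ i ∈ range (e * d), (if b i then 1 else -1) * ω ^ i = 0 := by
  rw [sum_range_mul_eq]
  have h3 : ∀ s t, (if b (s * d + t) then (1 : ℂ) else -1) * ω ^ (s * d + t) =
      (-ω ^ d) ^ s * ((if b t then 1 else -1) * ω ^ t) := by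
    intro s t
    rw [add_comm, antiperiodic_mul_odd hb, pow_add, neg_pow, ← pow_mul, mul_comm d s]
    rcases Nat.even_or_odd s with h | h
    · rw [h.neg_one_pow]; cases b t <;> simp [Nat.not_odd_iff_even.2 h] <;> ring
    · rw [h.neg_one_pow]; cases b t <;> simp [h] <;> ring
  simp_rw [h3, ← mul_sum, ← sum_mul]
  have h4 : -ω ^ d ≠ 1 := fun h => h2 (neg_eq_iff_eq_neg.1 h)
  rw [geom_sum_eq h4, neg_pow, he.neg_one_pow, ← pow_mul, mul_comm d e, h1]
  simp

theorem zeta_pow_ne_neg_one {n k : ℕ} (hk : 0 < k) (hkn : k < n) : zeta n ^ k ≠ -1 := by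
  intro h
  have h1 := congrArg Complex.im h
  have hk' : (0 : ℝ) < k := by exact_mod_cast hk
  have hkn' : (k : ℝ) < n := by exact_mod_cast hkn
  have hn : (0 : ℝ) < n := hk'.trans hkn'
  rw [zeta_pow, Complex.exp_ofReal_mul_I_im, Complex.neg_im, Complex.one_im, neg_zero] at h1
  refine (Real.sin_pos_of_pos_of_lt_pi (mul_pos hk' (div_pos Real.pi_pos hn)) ?_).ne' h1
  rw [← mul_div_assoc, div_lt_iff₀ hn, mul_comm]
  exact mul_lt_mul_of_pos_left hkn' Real.pi_pos

/-- Interleaving of `r` sequences. -/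
def interleave (r : ℕ) (B : ℕ → ℕ → Bool) (k : ℕ) : Bool := B (k % r) (k / r)

theorem interleave_apply {r : ℕ} (B : ℕ → ℕ → Bool) {j : ℕ} (hj : j < r) (i : ℕ) :
    interleave r B (i * r + j) = B j i := by
  have hr : 0 < r := by omega
  rw [interleave, mul_comm, Nat.mul_add_mod, Nat.mod_eq_of_lt hj, Nat.mul_add_div hr,
    Nat.div_eq_of_lt hj, add_zero]

/-- The signed sum splits by residues modulo `r`, and each row already sums to zero against the
powers of `zeta n ^ r`. -/
theorem isBalanced_interleave {p q r : ℕ} (hp : Odd p) (hp1 : 1 < p) (hq : Odd q) (hq1 : 1 < q)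
    (hr : 0 < r) {B : ℕ → ℕ → Bool}
    (hB : ∀ j, (∀ i, B j (i + q) = !B j i) ∨ ∀ i, B j (i + p) = !B j i) :
    IsBalanced (p * q * r) (interleave r B) := by
  have hn0 : p * q * r ≠ 0 := by positivity
  refine ⟨fun k => ?_, ?_⟩
  · rw [interleave, interleave, Nat.add_mul_mod_self_right, Nat.add_mul_div_right _ _ hr]
    rcases hB (k % r) with h | h
    · rw [antiperiodic_mul_odd h]; simp [hp]
    · rw [mul_comm p, antiperiodic_mul_odd h]; simp [hq]
  · rw [sum_range_mul_eq, sum_comm]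
    refine Finset.sum_eq_zero fun j hj => ?_
    have h1 : ∀ i, (if interleave r B (i * r + j) then (1 : ℂ) else -1) *
        zeta (p * q * r) ^ (i * r + j) = zeta (p * q * r) ^ j *
          ((if B j i then 1 else -1) * (zeta (p * q * r) ^ r) ^ i) := by
      intro i
      rw [interleave_apply B (mem_range.1 hj), pow_add, ← pow_mul, mul_comm r i]
      ring
    simp_rw [h1, ← mul_sum]
    have hζ : (zeta (p * q * r) ^ r) ^ (p * q) = -1 := by
      rw [← pow_mul, mul_comm r, zeta_pow_self hn0]
    have hqr : 0 < q * r := by positivity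
    have hpr : 0 < p * r := by positivity
    rcases hB j with h | h
    · rw [sum_antiperiodic_eq_zero h hp hζ, mul_zero]
      rw [← pow_mul, mul_comm r]
      refine zeta_pow_ne_neg_one hqr ?_
      rw [mul_assoc]
      exact lt_mul_of_one_lt_left hqr hp1
    · rw [mul_comm p q] at hζ ⊢
      rw [sum_antiperiodic_eq_zero h hq hζ, mul_zero]
      rw [← pow_mul, mul_comm r]
      refine zeta_pow_ne_neg_one hpr ?_
      rw [mul_assoc]
      exact lt_mul_of_one_lt_left hpr hq1

/-- A sequence of antiperiod `q`, or a fixed sequence of antiperiod `p`. -/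
def mixedSeq (p : ℕ) {q : ℕ} (hq : 0 < q) : Option (Fin q → Bool) → ℕ → Bool
  | none, i => Bool.xor (decide (Odd i)) (decide (p ∣ i))
  | some v, i => Bool.xor (v ⟨i % q, Nat.mod_lt i hq⟩) (decide (Odd (i / q)))

theorem mixedSeq_none {p q : ℕ} (hp : Odd p) (hq : 0 < q) (i : ℕ) :
    mixedSeq p hq none (i + p) = !mixedSeq p hq none i := by
  have h : decide (Odd (i + p)) = !decide (Odd i) := by
    rw [← decide_not, decide_eq_decide, Nat.odd_add]
    rw [← Nat.not_odd_iff_even]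
    tauto
  simp [mixedSeq, h]

theorem mixedSeq_some (p : ℕ) {q : ℕ} (hq : 0 < q) (v : Fin q → Bool) (i : ℕ) :
    mixedSeq p hq (some v) (i + q) = !mixedSeq p hq (some v) i := by
  simp only [mixedSeq, Nat.add_mod_right, Nat.add_div_right i hq, decide_odd_succ,
    Bool.xor_not]

theorem mixedSeq_injective {p q : ℕ} (hp1 : 1 < p) (hq0 : 0 < q) (hq : Odd q) (hpq : ¬ p ∣ q)
    {φ ψ : Option (Fin q → Bool)}
    (h : ∀ i < p * q, mixedSeq p hq0 φ i = mixedSeq p hq0 ψ i) : φ = ψ := by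
  have hqlt : q < p * q := lt_mul_of_one_lt_left hq0 hp1
  have key : ∀ v : Fin q → Bool, ¬ ∀ i < p * q, mixedSeq p hq0 none i =
      mixedSeq p hq0 (some v) i := by
    intro v hv
    have h1 := hv 0 (by omega)
    have h2 := hv q hqlt
    -- The sequence of antiperiod `p` lacks antiperiod `q`, as its values at `0` and `q` agree: `p`
    -- divides `0` but not `q`. So it is a genuinely additional choice.
    have h3 := mixedSeq_some p hq0 v 0
    rw [zero_add, ← h1, ← h2] at h3
    simp [mixedSeq, hq, hpq] at h3
  rcases φ with _ | v <;> rcases ψ with _ | v'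
  · rfl
  · exact absurd h (key v')
  · exact absurd (fun i hi => (h i hi).symm) (key v)
  · congr 1
    funext t
    have h1 := h t (t.isLt.trans hqlt)
    simpa [mixedSeq, Nat.mod_eq_of_lt t.isLt, Nat.div_eq_of_lt t.isLt] using h1

/-- A table of sequences, the rows of which are alternating except those with index in
`[1, r]`. -/
def mixedTable (p : ℕ) {q : ℕ} (hq : 0 < q) {r : ℕ} (φ : Fin r → Option (Fin q → Bool)) (j : ℕ) :
    ℕ → Bool :=
  if h : 1 ≤ j ∧ j ≤ r then mixedSeq p hq (φ ⟨j - 1, by omega⟩) else fun i => decide (Odd i)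

theorem pow_le_mul_ncard_reinhardtClasses {p q r : ℕ} (hp : Odd p) (hp1 : 1 < p) (hq : Odd q)
    (hq1 : 1 < q) (hpq : ¬ p ∣ q) :
    (2 ^ q + 1) ^ r ≤ 2 * (p * q * (r + 2) + 1) * (reinhardtClasses (p * q * (r + 2))).ncard := by
  have hq0 : 0 < q := by omega
  have hp0 : 0 < p := by omega
  have hpq0 : 2 * 2 ≤ p * q := Nat.mul_le_mul hp1 hq1
  have hpqodd : Odd (p * q) := hp.mul hq
  have hn : 4 * 2 ≤ p * q * (r + 2) := Nat.mul_le_mul hpq0 (by omega)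
  have := card_le_mul_ncard_reinhardtClasses (n := p * q * (r + 2))
    (ι := Fin r → Option (Fin q → Bool)) (by omega)
    (fun φ => interleave (r + 2) (mixedTable p hq0 φ)) (fun φ => ?_) (fun φ => ?_) (fun φ => ?_)
    (fun φ ψ h => ?_)
  · simpa using this
  · refine isBalanced_interleave hp hp1 hq hq1 (by omega) fun j => ?_
    unfold mixedTable
    split_ifs with h
    · cases φ ⟨j - 1, by omega⟩ with
      | none => exact Or.inr (mixedSeq_none hp hq0)
      | some v => exact Or.inl (mixedSeq_some p hq0 v)
    · left
      intro i
      rw [← decide_not, decide_eq_decide, Nat.odd_add, ← Nat.not_odd_iff_even]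
      tauto
  -- Rows `0` and `r + 1` are kept alternating to fix the first and last entries; the last one sits
  -- in row `r + 1` at the even position `p * q - 1`.
  · simp [interleave, mixedTable]
  · have h1 : p * q * (r + 2) - 1 = (p * q - 1) * (r + 2) + (r + 1) := by
      obtain ⟨m, hm⟩ : ∃ m, p * q = m + 1 := ⟨p * q - 1, by omega⟩
      rw [hm, add_mul, Nat.add_sub_cancel]
      omega
    have h2 : ¬ Odd (p * q - 1) := by
      obtain ⟨m, hm⟩ := hpqodd
      rw [hm, Nat.add_sub_cancel]
      simp
    simp only [h1]
    rw [interleave_apply _ (by omega), mixedTable, dif_neg (by omega)]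
    simpa using h2
  · funext j
    refine mixedSeq_injective hp1 hq0 hq hpq fun i hi => ?_
    have hj := j.isLt
    have hlt : i * (r + 2) + (j + 1) < p * q * (r + 2) := by
      have := Nat.mul_le_mul_right (r + 2) (show i + 1 ≤ p * q from hi)
      rw [add_mul, one_mul] at this
      omega
    have h1 := h _ hlt
    rw [interleave_apply _ (by omega), interleave_apply _ (by omega)] at h1
    have key : ∀ φ : Fin r → Option (Fin q → Bool),
        mixedTable p hq0 φ (j + 1) = mixedSeq p hq0 (φ j) := by
      intro φ
      rw [mixedTable, dif_pos (by omega)]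
      rfl
    rwa [key, key] at h1

/-- If periodic classes were at least as many as sporadic ones, the total would be at most `2 * 2 ^
(n / p)`; this and the class size `2 * (n + 1)` give the factor `4`. -/
theorem numPeriodic_lt_numSporadic {p q r : ℕ} (hp : Odd p) (hp1 : 1 < p) (hq : Odd q)
    (hq1 : 1 < q) (hpq : ¬ p ∣ q)
    (hmin : ∀ s, s.Prime → Odd s → s ∣ p * q * (r + 2) → p ≤ s)
    (hlt : 4 * (p * q * (r + 2) + 1) * 2 ^ (q * (r + 2)) < (2 ^ q + 1) ^ r) :
    numPeriodic (p * q * (r + 2)) < numSporadic (p * q * (r + 2)) := by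
  have h1 := pow_le_mul_ncard_reinhardtClasses (r := r) hp hp1 hq hq1 hpq
  have hq0 : 0 < q := by omega
  have hp0 : 0 < p := by omega
  have h2 := numPeriodic_le (by positivity) hp0 hmin
  rw [mul_assoc p, Nat.mul_div_cancel_left _ hp0, ← mul_assoc p] at h2
  rw [← numPeriodic_add_numSporadic] at h1
  by_contra! h3
  have h4 : numPeriodic (p * q * (r + 2)) + numSporadic (p * q * (r + 2)) ≤
      2 * 2 ^ (q * (r + 2)) := by omega
  have h5 := h1.trans (Nat.mul_le_mul_left _ h4)
  refine absurd (hlt.trans_le h5) (not_lt.2 (le_of_eq ?_))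
  ring

/-! ### Density -/

theorem hasNaturalDensity_one_of_ncard_compl_le {A : Set ℕ}
    (h : ∀ δ : ℝ, 0 < δ → ∃ C : ℝ, ∀ N : ℕ, ((Aᶜ ∩ Set.Icc 1 N).ncard : ℝ) ≤ δ * N + C) :
    HasNaturalDensity A 1 := by
  rw [HasNaturalDensity, Metric.tendsto_atTop]
  intro ε hε
  obtain ⟨C, hC⟩ := h (ε / 2) (half_pos hε)
  obtain ⟨N₀, hN₀⟩ := exists_nat_gt (2 * C / ε)
  refine ⟨max N₀ 1, fun N hN => ?_⟩
  have hN1 : (0 : ℝ) < N := by exact_mod_cast (le_max_right N₀ 1).trans hN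
  have hN2 : 2 * C / ε < N := hN₀.trans_le (by exact_mod_cast (le_max_left N₀ 1).trans hN)
  have hcard : (((A ∩ Set.Icc 1 N).ncard : ℝ) + (Aᶜ ∩ Set.Icc 1 N).ncard) = N := by
    have h1 := Set.ncard_inter_add_ncard_sdiff_eq_ncard (Set.Icc 1 N) A (Set.finite_Icc 1 N)
    rw [Set.inter_comm, Set.sdiff_eq, Set.inter_comm (Set.Icc 1 N)] at h1
    have h2 : (Set.Icc 1 N).ncard = N := by
      rw [← coe_Icc, Set.ncard_coe_finset, Nat.card_Icc, Nat.add_sub_cancel]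
    rw [h2] at h1
    exact_mod_cast h1
  have e : ((A ∩ Set.Icc 1 N).ncard : ℝ) / N - 1 = -((Aᶜ ∩ Set.Icc 1 N).ncard / N) := by
    field_simp
    linarith
  rw [Real.dist_eq, e, abs_neg, abs_of_nonneg (by positivity), div_lt_iff₀ hN1]
  rw [div_lt_iff₀ hε] at hN2
  linarith [hC N]

/-- Since `1 - x ≤ exp (-x)`, the divergence of the sum of prime reciprocals drives the product to
zero. -/
theorem exists_primes_prod_lt (Y : ℕ) {ε : ℝ} (hε : 0 < ε) :
    ∃ S : Finset ℕ, (∀ p ∈ S, p.Prime ∧ Y < p) ∧ ∏ p ∈ S, (1 - (p : ℝ)⁻¹) < ε := by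
  classical
  have h1 := not_summable_one_div_on_primes
  rw [not_summable_iff_tendsto_nat_atTop_of_nonneg
    (fun n => Set.indicator_nonneg (fun _ _ => by positivity) n)] at h1
  set f : ℕ → ℝ := Set.indicator {p | p.Prime} fun n : ℕ => (1 : ℝ) / n with hf
  obtain ⟨N, hN, hYN⟩ := ((h1.eventually_ge_atTop
    (∑ i ∈ range (Y + 1), f i + (1 - Real.log ε))).and (eventually_ge_atTop (Y + 1))).exists
  refine ⟨(Ico (Y + 1) N).filter Nat.Prime, fun p hp => ?_, ?_⟩
  · rw [mem_filter, mem_Ico] at hp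
    exact ⟨hp.2, hp.1.1⟩
  · have h2 : 1 - Real.log ε ≤ ∑ p ∈ (Ico (Y + 1) N).filter Nat.Prime, (p : ℝ)⁻¹ := by
      have h3 : ∑ p ∈ (Ico (Y + 1) N).filter Nat.Prime, (p : ℝ)⁻¹ =
          ∑ p ∈ Ico (Y + 1) N, f p := by
        rw [sum_filter]
        refine sum_congr rfl fun p _ => ?_
        simp [hf, Set.indicator_apply]
      rw [h3, sum_Ico_eq_sub _ hYN]
      linarith
    calc ∏ p ∈ (Ico (Y + 1) N).filter Nat.Prime, (1 - (p : ℝ)⁻¹)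
        ≤ ∏ p ∈ (Ico (Y + 1) N).filter Nat.Prime, Real.exp (-(p : ℝ)⁻¹) := by
          refine prod_le_prod (fun p hp => ?_) fun p _ => Real.one_sub_le_exp_neg _
          have hp1 : (1 : ℝ) ≤ p := by exact_mod_cast (mem_filter.1 hp).2.one_le
          exact sub_nonneg.2 (inv_le_one_of_one_le₀ hp1)
      _ = Real.exp (-∑ p ∈ (Ico (Y + 1) N).filter Nat.Prime, (p : ℝ)⁻¹) := by
          rw [← Real.exp_sum, sum_neg_distrib]
      _ ≤ Real.exp (Real.log ε - 1) := Real.exp_le_exp.2 (by linarith)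
      _ < ε := by
          rw [← Real.lt_log_iff_exp_lt hε]
          linarith

/-- These are integers coprime to the product `M` of `S`, at most `M.totient` in each block of `M`
consecutive ones. -/
theorem ncard_no_prime_factor_le {S : Finset ℕ} (hS : ∀ p ∈ S, p.Prime) (N : ℕ) :
    (({n | ∀ p ∈ S, ¬ p ∣ n} ∩ Set.Icc 1 N).ncard : ℝ) ≤
      (∏ p ∈ S, (1 - (p : ℝ)⁻¹)) * N + ∏ p ∈ S, (p : ℝ) := by
  set M := ∏ p ∈ S, p with hM
  have hM0 : M ≠ 0 := prod_ne_zero_iff.2 fun p hp => (hS p hp).ne_zero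
  have h1 : ({n | ∀ p ∈ S, ¬ p ∣ n} ∩ Set.Icc 1 N) ⊆
      ((Ico 1 (1 + N)).filter fun n => M.Coprime n : Finset ℕ) := by
    rintro n ⟨hn, hn1, hn2⟩
    rw [mem_coe, mem_filter, mem_Ico]
    refine ⟨⟨hn1, by omega⟩, Nat.Coprime.prod_left fun p hp => ?_⟩
    exact (Nat.Prime.coprime_iff_not_dvd (hS p hp)).2 (hn p hp)
  have h2 := (Set.ncard_le_ncard h1 (finite_toSet _)).trans_eq (Set.ncard_coe_finset _)
  have h3 := h2.trans (Nat.Ico_filter_coprime_le 1 N hM0)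
  have h4 : (M.totient : ℝ) = M * ∏ p ∈ S, (1 - (p : ℝ)⁻¹) := by
    have h5 := Nat.totient_eq_mul_prod_factors M
    rw [hM, Nat.primeFactors_prod hS, ← hM] at h5
    have h6 := congrArg (fun x : ℚ => (x : ℝ)) h5
    push_cast at h6
    exact h6
  have hMpos : (0 : ℝ) < M := by exact_mod_cast Nat.pos_of_ne_zero hM0
  have hdiv : ((N / M : ℕ) : ℝ) ≤ N / M := Nat.cast_div_le
  have htot : (M.totient : ℝ) ≤ M := by exact_mod_cast Nat.totient_le M
  have hMcast : ∏ p ∈ S, (p : ℝ) = M := by rw [hM]; push_cast; rfl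
  calc (({n | ∀ p ∈ S, ¬ p ∣ n} ∩ Set.Icc 1 N).ncard : ℝ)
      ≤ M.totient * ((N / M : ℕ) + 1) := by exact_mod_cast h3
    _ ≤ M.totient * (N / M + 1) := by gcongr
    _ = (∏ p ∈ S, (1 - (p : ℝ)⁻¹)) * N + M.totient := by
        rw [mul_add, mul_one, h4]; field_simp
    _ ≤ _ := by rw [hMcast]; gcongr

theorem eventually_growth (p q : ℕ) (hp : 0 < p) (hq : 0 < q) :
    ∀ᶠ r : ℕ in atTop, 4 * (p * q * (r + 2) + 1) * 2 ^ (q * (r + 2)) < (2 ^ q + 1) ^ r := by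
  set a : ℝ := (2 ^ q + 1) / 2 ^ q with ha
  have hpow : (0 : ℝ) < 2 ^ q := by positivity
  have ha1 : 1 < a := by rw [ha, one_lt_div hpow]; linarith
  have hpq : (1 : ℝ) ≤ p * q := by exact_mod_cast Nat.mul_pos hp hq
  have h1 := tendsto_pow_const_div_const_pow_of_one_lt 1 ha1
  have hc : (0 : ℝ) < 1 / (16 * (p * q) * (2 ^ q) ^ 2) := by positivity
  -- After division by `(2 ^ q) ^ r` a linear function of `r` faces `a ^ r` with `a > 1`; the
  -- constant `16` is `4 * 4`, from `p * q * (r + 2) + 1 ≤ 4 * (p * q) * r`.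
  filter_upwards [h1.eventually_lt_const hc, eventually_ge_atTop 1] with r hr hr1
  have hr1' : (1 : ℝ) ≤ r := by exact_mod_cast hr1
  have har : 0 < a ^ r := by positivity
  rw [pow_one, div_lt_div_iff₀ har (by positivity), one_mul] at hr
  have h2 : (p * q * (r + 2) + 1 : ℝ) ≤ 4 * (p * q) * r := by nlinarith
  have h3 : ((2 : ℝ) ^ q + 1) ^ r = a ^ r * (2 ^ q) ^ r := by
    rw [ha, div_pow]; field_simp
  have h4 : (4 * (p * q * (r + 2) + 1) * 2 ^ (q * (r + 2)) : ℝ) < (2 ^ q + 1) ^ r := by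
    rw [h3, pow_mul, pow_add, mul_comm ((2 ^ q : ℝ) ^ r), ← mul_assoc]
    refine mul_lt_mul_of_pos_right (lt_of_le_of_lt ?_ hr) (by positivity)
    calc (4 * (p * q * (r + 2) + 1) * (2 ^ q) ^ 2 : ℝ)
        ≤ 4 * (4 * (p * q) * r) * (2 ^ q) ^ 2 := by gcongr
      _ = r * (16 * (p * q) * (2 ^ q) ^ 2) := by ring
  exact_mod_cast h4

theorem exists_forall_numPeriodic_lt_numSporadic (Y : ℕ) :
    ∃ N₀ : ℕ, ∀ n, N₀ < n → ∀ s t : ℕ, s.Prime → t.Prime → Odd s → Odd t → s ≠ t → s ≤ Y →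
      t ≤ Y → s ∣ n → t ∣ n → numPeriodic n < numSporadic n := by
  have h : ∀ p q : ℕ, ∃ R : ℕ, 0 < p → 0 < q → ∀ r, R ≤ r →
      4 * (p * q * (r + 2) + 1) * 2 ^ (q * (r + 2)) < (2 ^ q + 1) ^ r := by
    intro p q
    by_cases hpq : 0 < p ∧ 0 < q
    · obtain ⟨R, hR⟩ := eventually_atTop.1 (eventually_growth p q hpq.1 hpq.2)
      exact ⟨R, fun _ _ => hR⟩
    · exact ⟨0, fun h1 h2 => absurd ⟨h1, h2⟩ hpq⟩
  choose R hR using h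
  -- A sum over the finitely many pairs serves as a common upper bound for all thresholds.
  set R₀ := ∑ p ∈ range (Y + 1), ∑ q ∈ range (Y + 1), R p q with hR₀
  have key : ∀ p ≤ Y, ∀ q ≤ Y, R p q ≤ R₀ := by
    intro p hp q hq
    have h1 : R p q ≤ ∑ q ∈ range (Y + 1), R p q :=
      single_le_sum (f := fun q => R p q) (fun _ _ => Nat.zero_le _) (mem_range.2 (by omega))
    exact h1.trans (single_le_sum (f := fun p => ∑ q ∈ range (Y + 1), R p q)
      (fun _ _ => Nat.zero_le _) (mem_range.2 (by omega)))
  refine ⟨Y * Y * (R₀ + 2), fun n hn s t hs ht hs2 ht2 hst hsY htY hsn htn => ?_⟩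
  classical
  have hex : ∃ p : ℕ, p.Prime ∧ Odd p ∧ p ∣ n := ⟨s, hs, hs2, hsn⟩
  obtain ⟨hp, hp2, hpn⟩ := Nat.find_spec hex
  have hmin : ∀ u : ℕ, u.Prime → Odd u → u ∣ n → Nat.find hex ≤ u := fun u h1 h2 h3 =>
    Nat.find_min' hex ⟨h1, h2, h3⟩
  have hpY := (hmin s hs hs2 hsn).trans hsY
  generalize Nat.find hex = p at *
  obtain ⟨q, hq, hq2, hqY, hqn, hpq⟩ : ∃ q : ℕ, q.Prime ∧ Odd q ∧ q ≤ Y ∧ q ∣ n ∧ p ≠ q := by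
    by_cases hps : p = s
    · exact ⟨t, ht, ht2, htY, htn, hps ▸ hst⟩
    · exact ⟨s, hs, hs2, hsY, hsn, hps⟩
  obtain ⟨k, rfl⟩ := Nat.Coprime.mul_dvd_of_dvd_of_dvd ((Nat.coprime_primes hp hq).2 hpq) hpn hqn
  have hk : R₀ + 2 < k := by
    refine Nat.lt_of_mul_lt_mul_left (a := Y * Y) (hn.trans_le ?_)
    exact Nat.mul_le_mul_right _ (Nat.mul_le_mul hpY hqY)
  obtain ⟨r, rfl⟩ : ∃ r, k = r + 2 := ⟨k - 2, by omega⟩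
  exact numPeriodic_lt_numSporadic hp2 hp.one_lt hq2 hq.one_lt
    (fun h => hpq ((Nat.prime_dvd_prime_iff_eq hp hq).1 h)) hmin
    (hR p q hp.pos hq.pos r ((key p hpY q hqY).trans (by omega)))

end Counting

end Reinhardt

open Finset Reinhardt

/-- For almost all positive integers `n`, there are more sporadic Reinhardt polygons with `n` sides
than periodic ones. -/
theorem mainTheorem1 :
    Reinhardt.HasNaturalDensity {n : ℕ | Reinhardt.numPeriodic n < Reinhardt.numSporadic n} 1 := by
  refine hasNaturalDensity_one_of_ncard_compl_le fun δ hδ => ?_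
  obtain ⟨S, hS, hSδ⟩ := exists_primes_prod_lt 2 (half_pos hδ)
  -- Primes of `T` exceed the sum of `S`, hence every element of `S`, so the two prime factors found
  -- below are distinct.
  obtain ⟨T, hT, hTδ⟩ := exists_primes_prod_lt (2 + ∑ p ∈ S, p) (half_pos hδ)
  have hSle : ∀ p ∈ S, p ≤ ∑ p ∈ S, p := fun p hp =>
    single_le_sum (f := fun p => p) (fun _ _ => Nat.zero_le _) hp
  have hTle : ∀ p ∈ T, p ≤ ∑ p ∈ T, p := fun p hp =>
    single_le_sum (f := fun p => p) (fun _ _ => Nat.zero_le _) hp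
  obtain ⟨N₀, hN₀⟩ := exists_forall_numPeriodic_lt_numSporadic (∑ p ∈ S, p + ∑ p ∈ T, p)
  refine ⟨∏ p ∈ S, (p : ℝ) + ∏ p ∈ T, (p : ℝ) + N₀, fun N => ?_⟩
  have hsub : {n : ℕ | numPeriodic n < numSporadic n}ᶜ ∩ Set.Icc 1 N ⊆
      (({n | ∀ p ∈ S, ¬ p ∣ n} ∩ Set.Icc 1 N) ∪ ({n | ∀ p ∈ T, ¬ p ∣ n} ∩ Set.Icc 1 N)) ∪
        (Icc 1 N₀ : Finset ℕ) := by
    rintro n ⟨hn, hnN⟩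
    by_contra hcon
    simp only [Set.mem_union, not_or, Set.mem_inter_iff, not_and, coe_Icc] at hcon
    obtain ⟨⟨h1, h2⟩, h3⟩ := hcon
    have h1' : ¬ ∀ p ∈ S, ¬ p ∣ n := fun h => h1 h hnN
    have h2' : ¬ ∀ p ∈ T, ¬ p ∣ n := fun h => h2 h hnN
    push Not at h1' h2'
    obtain ⟨s, hs, hsn⟩ := h1'
    obtain ⟨t, ht, htn⟩ := h2'
    have h4 := hSle s hs
    have h5 := hTle t ht
    have h6 := hS s hs
    have h7 := hT t ht
    refine hn (hN₀ n ?_ s t h6.1 h7.1 (h6.1.odd_of_ne_two (by omega))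
      (h7.1.odd_of_ne_two (by omega)) (by omega) (by omega) (by omega) hsn htn)
    by_contra! h
    exact h3 ⟨hnN.1, h⟩
  have hfin : ∀ A : Set ℕ, (A ∩ Set.Icc 1 N).Finite := fun A =>
    (Set.finite_Icc 1 N).subset Set.inter_subset_right
  have hcard := (Set.ncard_le_ncard hsub (((hfin _).union (hfin _)).union (finite_toSet _))).trans
    ((Set.ncard_union_le _ _).trans (Nat.add_le_add_right (Set.ncard_union_le _ _) _))
  rw [Set.ncard_coe_finset, Nat.card_Icc, Nat.add_sub_cancel] at hcard
  have hcard' := (Nat.cast_le (α := ℝ)).2 hcard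
  push_cast at hcard'
  have b1 := ncard_no_prime_factor_le (fun p hp => (hS p hp).1) N
  have b2 := ncard_no_prime_factor_le (fun p hp => (hT p hp).1) N
  have b3 := mul_le_mul_of_nonneg_right hSδ.le (Nat.cast_nonneg (α := ℝ) N)
  have b4 := mul_le_mul_of_nonneg_right hTδ.le (Nat.cast_nonneg (α := ℝ) N)
  linarith
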